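/- A labelled tree is a finite plane (rooted, ordered) tree whose nodes carry integer labels, such that the root has label $0$ and the labels of any two adjacent nodes differ by $\pm1$. Let $T\equiv T(t)\in\mathbb{Q}[[t]]$ be the generating function of labelled trees counted by edges, and let $\tilde T\equiv T(tu)$. For $j\in\mathbb{Z}$, let $R_j\equiv R_j(t,u)\in\mathbb{Q}[u][[t]]$ be the generating function of labelled trees counted by the number of edges (variable $t$) and the number of nodes with label at least $j$ (variable $u$). (1) For every $j\in\mathbb{Z}$, $R_j$ is algebraic of degree at most $2$ over $\mathbb{Q}(T,\tilde T)$, and it has degree at most $8$ over $\mathbb{Q}(t,u)$. More precisely, for every $j\in\mathbb Z$, $R_j$ belongs to the extension of $\mathbb{Q}(T,\tilde T)$ generated by the power series in $t$, with coefficients in $\mathbb Q[u]$ and constant term $2$, $$\sqrt{(T+\tilde T)^2-4T\tilde T(T-1)(\tilde T-1)}.$$ (2) Let $Z\equiv Z(t)\in\mathbb{Q}[[t]]$ be the unique formal power series with constant term $0$ satisfying $$Z=t\,\frac{(1+Z)^4}{1+Z^2}.$$ There is a formal power series $\nu\equiv\nu(t,u)$ in $t$, with coefficients in $\mathbb{Q}[u]$,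 such that for all $j\ge 0$, $$R_j=T\,\frac{(1+\nu Z^j)(1+\nu Z^{j+4})}{(1+\nu Z^{j+1})(1+\nu Z^{j+3})}.$$ This series $\nu$ is algebraic of degree $4$ over $\mathbb{Q}(u,Z)$ and of degree $16$ over $\mathbb{Q}(t,u)$, it satisfies $\nu(t,1)=0$, and its expansion begins $$\nu(t,u)=(u-1)\left(1+2ut+(7u+6u^2)t^2+(32u+36u^2+23u^3)t^3+O(t^4)\right).$$ -/

import Mathlib

open scoped Polynomial PowerSeries

noncomputable section

/-- Finite plane (rooted, ordered) trees whose nodes carry an integer label: a node is given by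
its label and the ordered list of the subtrees attached to it. -/
inductive LTree : Type
  | node (label : ℤ) (children : List LTree) : LTree

namespace LTree

/-- The label of the root. -/
def rootLabel : LTree → ℤ
  | node a _ => a

mutual
/-- The number of edges of a tree. -/
def numEdges : LTree → ℕ
  | node _ cs => numEdgesForest cs
/-- The number of edges of the subtrees in a list, each counted with the edge joining it to its
parent. -/
def numEdgesForest : List LTree → ℕ
  | [] => 0
  | c :: cs => (numEdges c + 1) + numEdgesForest cs
end

mutual
/-- The number of nodes whose label is at least `j`. -/
def numNodesGE (j : ℤ) : LTree → ℕ
  | node a cs => (if j ≤ a then 1 else 0) + numNodesGEForest j cs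
/-- The number of nodes with label at least `j` in a list of trees. -/
def numNodesGEForest (j : ℤ) : List LTree → ℕ
  | [] => 0
  | c :: cs => numNodesGE j c + numNodesGEForest j cs
end

/-- The labels of any two adjacent nodes differ by `±1`. -/
inductive UnitSteps : LTree → Prop
  | node (a : ℤ) (cs : List LTree)
      (step : ∀ c ∈ cs, c.rootLabel = a + 1 ∨ c.rootLabel = a - 1)
      (sub : ∀ c ∈ cs, UnitSteps c) : UnitSteps (LTree.node a cs)

/-- The trees with root label `a`, steps `±1` and `n` edges. -/
def treesFrom (a : ℤ) (n : ℕ) : Set LTree :=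
  {τ | UnitSteps τ ∧ τ.rootLabel = a ∧ τ.numEdges = n}

theorem treesFrom_finite (n : ℕ) : ∀ a : ℤ, (treesFrom a n).Finite := by
  induction n using Nat.strong_induction_on with
  | _ n ih =>
    intro a
    let graft : LTree × LTree → LTree := fun p =>
      match p with
      | (c, node b cs) => node b (c :: cs)
    have hfin : (⋃ k ∈ Set.Iio n, graft ''
        ((treesFrom (a + 1) k ∪ treesFrom (a - 1) k) ×ˢ treesFrom a (n - 1 - k))).Finite := by
      refine Set.Finite.biUnion (Set.finite_Iio n) fun k hk => Set.Finite.image _ ?_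
      have hk' : k < n := hk
      exact ((ih k hk' _).union (ih k hk' _)).prod (ih _ (by omega) _)
    refine ((Set.finite_singleton (node a [])).union hfin).subset ?_
    rintro ⟨b, cs⟩ ⟨hu, hb, hn⟩
    obtain rfl : b = a := hb
    cases hu with
    | node _ _ step sub =>
      cases cs with
      | nil => exact Or.inl rfl
      | cons c cs =>
        right
        simp only [numEdges, numEdgesForest] at hn
        refine Set.mem_biUnion (x := c.numEdges) (show c.numEdges < n by omega) ?_
        refine ⟨(c, node b cs), ⟨?_, ?_⟩, rfl⟩
        · rcases step c (by simp) with h | h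
          · exact Or.inl ⟨sub c (by simp), h, rfl⟩
          · exact Or.inr ⟨sub c (by simp), h, rfl⟩
        · refine ⟨UnitSteps.node _ _ (fun d hd => step d (by simp [hd]))
            (fun d hd => sub d (by simp [hd])), rfl, ?_⟩
          simp only [numEdges]
          omega

/-- The finite set of labelled trees (root labelled `0`, labels of adjacent nodes differing by
`±1`) with `n` edges. -/
def labelledTrees (n : ℕ) : Finset LTree := (treesFrom_finite n 0).toFinset

/-- `R_j(t,u) = ∑ t^(number of edges) u^(number of nodes labelled ≥ j)`, summed over labelled
trees, as a power series in `t` whose coefficients are polynomials in `u`. -/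
def R (j : ℤ) : ℚ[X]⟦X⟧ :=
  PowerSeries.mk fun n => ∑ τ ∈ labelledTrees n, (Polynomial.X : ℚ[X]) ^ numNodesGE j τ

/-- `T(t)`, the generating function of labelled trees counted by edges. -/
def T : ℚ⟦X⟧ := PowerSeries.mk fun n => ((labelledTrees n).card : ℚ)

/-- A series in `t` with rational coefficients, seen as a series in `t` over `ℚ[u]`. -/
def constU (A : ℚ⟦X⟧) : ℚ[X]⟦X⟧ := PowerSeries.map Polynomial.C A

/-- `A(tu)`, for a series `A(t)` with rational coefficients. -/
def atTU (A : ℚ⟦X⟧) : ℚ[X]⟦X⟧ := PowerSeries.rescale (Polynomial.X : ℚ[X]) (constU A)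

/-- The variable `t`. -/
def t : ℚ[X]⟦X⟧ := PowerSeries.X

/-- The variable `u`. -/
def u : ℚ[X]⟦X⟧ := PowerSeries.C (Polynomial.X : ℚ[X])

/-- The fraction field of `ℚ[u]⟦t⟧`, in which all the degrees are computed. -/
abbrev K : Type := FractionRing ℚ[X]⟦X⟧

/-- The embedding of `ℚ[u]⟦t⟧` in its fraction field. -/
def toK : ℚ[X]⟦X⟧ →+* K := algebraMap ℚ[X]⟦X⟧ K

/-- `ℚ(A, B)`, the subfield of `K` generated by the series `A` and `B`. -/
def fieldGen (A B : ℚ[X]⟦X⟧) : IntermediateField ℚ K :=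
  IntermediateField.adjoin ℚ {toK A, toK B}

/-- `x` is algebraic over `F`, of degree at most `d`. -/
def DegreeLE (F : IntermediateField ℚ K) (x : ℚ[X]⟦X⟧) (d : ℕ) : Prop :=
  IsAlgebraic F (toK x) ∧ (minpoly F (toK x)).natDegree ≤ d

/-- `x` is algebraic over `F`, of degree exactly `d`. -/
def DegreeEq (F : IntermediateField ℚ K) (x : ℚ[X]⟦X⟧) (d : ℕ) : Prop :=
  IsAlgebraic F (toK x) ∧ (minpoly F (toK x)).natDegree = d

/-- `Z` has constant term `0` and satisfies `Z = t (1 + Z)^4 / (1 + Z^2)`. -/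
def IsZ (Z : ℚ⟦X⟧) : Prop :=
  PowerSeries.constantCoeff Z = 0 ∧
    Z = PowerSeries.X * (1 + Z) ^ 4 * (1 + Z ^ 2)⁻¹

end LTree

end

-- Removing the leftmost subtree of the root gives `R_j = w_j + t R_j (R_{j-1} + R_{j+1})`, with
-- `w_j = u` for `j ≤ 0` and `w_j = 1` for `j > 0` (`R_rec`). Where the weight is a constant `a`,
-- this recursion has a conserved quantity, `invariant a`, in two consecutive terms. As `j → ∞` the
-- terms tend `t`-adically to `T`, and as `j → -∞` to `u V` with `V = T(tu)`, so the pair `x = R_0`,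
-- `y = R_1` satisfies two explicit equations (`invariant_R_top`, `invariant_R_bot`). They share
-- their quartic term, since `(1 - tx)(1 - ty) = 1 + tc` with `c = txy - x - y`. Subtracting gives
-- `c`, then `xy`, then `x + y` as rational functions of `T` and `V`, and `(x - y)^2` is a square of
-- `ℚ(T,V)` times `disc T V`. The recursion carries membership in `ℚ(T,V,√disc)` to all `R_j`, and
-- the bound `8` comes from three extensions of degree at most `2`.
--
-- The product form solves the recursion for every value of `ν`. The series `ν` is fixed by matching
-- `R_0`, and `R_0` together with the recursion at `j > 0` determines the `R_j`, `j ≥ 0`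
-- (`recursion_unique`).
--
-- For the degrees of `ν`, each step of `ℚ(t,u) ⊂ ℚ(T,u) ⊂ ℚ(u,Z) ⊂ ℚ(Z,V) ⊂ ℚ(Z,V,ν)` is quadratic;
-- a step is proper because a squarefree nonconstant polynomial in a transcendental element is not a
-- square (`sq_ne_aeval_of_transcendental`). The top field is generated by `ν` over `ℚ(u,Z)` because
-- `V` is rational in `u, Z, ν` (`Rel.V_mem`), and over `ℚ(t,u)` because moreover `Z ∈ ℚ(t,u,ν)`: a
-- conjugate `Z'` of `Z` over that field would satisfy the same relations with the same `t, u, ν`,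
-- which forces `Z' = Z` (`Rel.Z_eq_of_rel`).

noncomputable section

namespace LTree

-- Decomposition of trees and the recursion for `R_j`

/-- The generating function of the trees with steps `±1` and root label `a`, counted by edges and
by nodes labelled at least `j`. -/
def rootedSeries (a j : ℤ) : ℚ[X]⟦X⟧ :=
  PowerSeries.mk fun n =>
    ∑ τ ∈ (treesFrom_finite n a).toFinset, (Polynomial.X : ℚ[X]) ^ numNodesGE j τ

/-- The weight of a node labelled `a`. -/
def nodeWeight (a j : ℤ) : ℚ[X] := if j ≤ a then Polynomial.X else 1

/-- Attach a tree as the leftmost subtree of the root of another tree. -/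
def graft : LTree → LTree → LTree
  | c, node b cs => node b (c :: cs)

theorem numEdges_graft (c τ : LTree) : (graft c τ).numEdges = c.numEdges + τ.numEdges + 1 := by
  cases τ; simp [graft, numEdges, numEdgesForest]; omega

theorem numNodesGE_graft (j : ℤ) (c τ : LTree) :
    numNodesGE j (graft c τ) = numNodesGE j c + numNodesGE j τ := by
  cases τ; simp [graft, numNodesGE, numNodesGEForest]; omega

theorem graft_injective {c τ c' τ' : LTree} (h : graft c τ = graft c' τ') : c = c' ∧ τ = τ' := by
  cases τ; cases τ'; simp_all [graft]

theorem unitSteps_graft {c τ : LTree} :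
    UnitSteps (graft c τ) ↔
      (c.rootLabel = τ.rootLabel + 1 ∨ c.rootLabel = τ.rootLabel - 1) ∧ UnitSteps c ∧
        UnitSteps τ := by
  cases τ with
  | node b cs =>
    constructor
    · intro h
      cases h with
      | node _ _ step sub =>
        exact ⟨step c (by simp), sub c (by simp),
          UnitSteps.node _ _ (fun d hd => step d (by simp [hd])) fun d hd => sub d (by simp [hd])⟩
    · rintro ⟨h1, h2, h3⟩
      cases h3 with
      | node _ _ step sub =>
        refine UnitSteps.node _ _ (fun d hd => ?_) fun d hd => ?_
        · rcases List.mem_cons.1 hd with rfl | hd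
          · exact h1
          · exact step d hd
        · rcases List.mem_cons.1 hd with rfl | hd
          · exact h2
          · exact sub d hd

theorem rootLabel_graft (c τ : LTree) : (graft c τ).rootLabel = τ.rootLabel := by
  cases τ; rfl

theorem mem_treesFrom {a : ℤ} {n : ℕ} {τ : LTree} :
    τ ∈ treesFrom a n ↔ UnitSteps τ ∧ τ.rootLabel = a ∧ τ.numEdges = n := Iff.rfl

theorem treesFrom_zero (a : ℤ) : treesFrom a 0 = {node a []} := by
  ext τ
  constructor
  · rintro ⟨-, h1, h2⟩
    cases τ with
    | node b cs =>
      obtain rfl : b = a := h1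
      cases cs with
      | nil => rfl
      | cons c cs => simp [numEdges, numEdgesForest] at h2
  · rintro rfl
    exact ⟨UnitSteps.node _ _ (by simp) (by simp), rfl, by simp [numEdges, numEdgesForest]⟩

theorem exists_graft_of_mem {a : ℤ} {n : ℕ} {τ : LTree} (h : τ ∈ treesFrom a (n + 1)) :
    ∃ c ρ, τ = graft c ρ := by
  cases τ with
  | node b cs =>
    cases cs with
    | nil => simp [treesFrom, numEdges, numEdgesForest] at h
    | cons c cs => exact ⟨c, node b cs, rfl⟩

theorem coeff_zero_rootedSeries (a j : ℤ) :
    PowerSeries.coeff 0 (rootedSeries a j) = nodeWeight a j := by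
  have : (treesFrom_finite 0 a).toFinset = {node a []} := by
    ext; simp [treesFrom_zero]
  rw [rootedSeries, PowerSeries.coeff_mk, this]
  simp only [nodeWeight, numNodesGE, numNodesGEForest, Finset.sum_singleton]
  split_ifs <;> simp

/-- A tree with an edge is uniquely `graft c ρ`. Node counts add up, and the new edge accounts for
the index shift. -/
theorem coeff_succ_rootedSeries (a j : ℤ) (n : ℕ) :
    PowerSeries.coeff (n + 1) (rootedSeries a j) =
      PowerSeries.coeff n ((rootedSeries (a + 1) j + rootedSeries (a - 1) j) *
        rootedSeries a j) := by
  classical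
  have key : ∀ k, PowerSeries.coeff k (rootedSeries (a + 1) j + rootedSeries (a - 1) j) =
      ∑ τ ∈ (treesFrom_finite k (a + 1)).toFinset ∪ (treesFrom_finite k (a - 1)).toFinset,
        (Polynomial.X : ℚ[X]) ^ numNodesGE j τ := by
    intro k
    rw [Finset.sum_union, map_add]
    · simp only [rootedSeries, PowerSeries.coeff_mk]
    · rw [Finset.disjoint_left]
      intro τ h1 h2
      simp only [Set.Finite.mem_toFinset, mem_treesFrom] at h1 h2
      omega
  rw [PowerSeries.coeff_mul]
  simp only [key]
  simp only [rootedSeries, PowerSeries.coeff_mk, Finset.sum_mul_sum, ← Finset.sum_product']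
  rw [Finset.sum_sigma']
  symm
  refine Finset.sum_bij (fun x _ => graft x.2.1 x.2.2) ?_ ?_ ?_ ?_
  · rintro ⟨⟨k, l⟩, c, ρ⟩ h
    simp only [Finset.mem_sigma, Finset.HasAntidiagonal.mem_antidiagonal, Finset.mem_product, Finset.mem_union,
      Set.Finite.mem_toFinset, mem_treesFrom] at h ⊢
    obtain ⟨h1, h2, h3, h4, h5⟩ := h
    refine ⟨unitSteps_graft.2 ⟨?_, ?_, h3⟩, ?_, ?_⟩
    · rw [h4]; exact h2.imp (fun h => h.2.1) (fun h => h.2.1)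
    · exact h2.elim (fun h => h.1) (fun h => h.1)
    · rw [rootLabel_graft, h4]
    · rw [numEdges_graft, h5]
      have : c.numEdges = k := h2.elim (fun h => h.2.2) (fun h => h.2.2)
      omega
  · rintro ⟨⟨k, l⟩, c, ρ⟩ h ⟨⟨k', l'⟩, c', ρ'⟩ h' heq
    obtain ⟨rfl, rfl⟩ := graft_injective heq
    simp only [Finset.mem_sigma, Finset.HasAntidiagonal.mem_antidiagonal, Finset.mem_product, Finset.mem_union,
      Set.Finite.mem_toFinset, mem_treesFrom] at h h'
    obtain ⟨h1, h2, h3, h4, h5⟩ := h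
    obtain ⟨h1', h2', h3', h4', h5'⟩ := h'
    have e1 : c.numEdges = k := h2.elim (fun h => h.2.2) (fun h => h.2.2)
    have e2 : c.numEdges = k' := h2'.elim (fun h => h.2.2) (fun h => h.2.2)
    obtain rfl : k = k' := by omega
    obtain rfl : l = l' := by omega
    rfl
  · intro τ h
    simp only [Set.Finite.mem_toFinset] at h
    obtain ⟨c, ρ, rfl⟩ := exists_graft_of_mem h
    obtain ⟨h1, h2, h3⟩ := h
    rw [rootLabel_graft] at h2
    rw [numEdges_graft] at h3
    rw [unitSteps_graft, h2] at h1
    refine ⟨⟨(c.numEdges, ρ.numEdges), c, ρ⟩, ?_, rfl⟩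
    simp only [Finset.mem_sigma, Finset.HasAntidiagonal.mem_antidiagonal, Finset.mem_product, Finset.mem_union,
      Set.Finite.mem_toFinset, mem_treesFrom]
    exact ⟨by omega, h1.1.imp (fun h => ⟨h1.2.1, h, trivial⟩) (fun h => ⟨h1.2.1, h, trivial⟩),
      h1.2.2, h2, trivial⟩
  · rintro ⟨⟨k, l⟩, c, ρ⟩ h
    simp only [numNodesGE_graft, pow_add]

theorem rootedSeries_eq (a j : ℤ) :
    rootedSeries a j = PowerSeries.C (nodeWeight a j) +
      PowerSeries.X * ((rootedSeries (a + 1) j + rootedSeries (a - 1) j) * rootedSeries a j) := by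
  ext1 n
  cases n with
  | zero => simp [coeff_zero_rootedSeries]
  | succ n =>
    rw [coeff_succ_rootedSeries, map_add, PowerSeries.coeff_succ_X_mul, PowerSeries.coeff_C,
      if_neg (by omega), zero_add]

/-- The recursion and its initial weights depend only on `j - a`, so no bijection between trees is
needed. -/
theorem coeff_rootedSeries_add (n : ℕ) (a j c : ℤ) :
    PowerSeries.coeff n (rootedSeries (a + c) (j + c)) = PowerSeries.coeff n (rootedSeries a j) := by
  induction n using Nat.strong_induction_on generalizing a with
  | _ n ih =>
    cases n with
    | zero => simp [coeff_zero_rootedSeries, nodeWeight]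
    | succ n =>
      rw [coeff_succ_rootedSeries, coeff_succ_rootedSeries, PowerSeries.coeff_mul,
        PowerSeries.coeff_mul]
      refine Finset.sum_congr rfl fun p hp => ?_
      have := Finset.HasAntidiagonal.mem_antidiagonal.1 hp
      rw [map_add, map_add, show a + c + 1 = a + 1 + c by ring, show a + c - 1 = a - 1 + c by ring,
        ih _ (by omega), ih _ (by omega), ih _ (by omega)]

theorem R_eq_rootedSeries (a j : ℤ) : R (j - a) = rootedSeries a j := by
  ext1 n
  rw [← coeff_rootedSeries_add n a j (-a), add_neg_cancel]
  rfl

theorem R_rec (j : ℤ) :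
    R j = PowerSeries.C (nodeWeight 0 j) + t * R j * (R (j - 1) + R (j + 1)) := by
  have h := rootedSeries_eq 0 j
  rw [← R_eq_rootedSeries, ← R_eq_rootedSeries, ← R_eq_rootedSeries] at h
  simp only [sub_zero, zero_add, zero_sub, sub_neg_eq_add] at h
  conv_lhs => rw [h]
  rw [t]; ring

theorem R_rec_of_pos {j : ℤ} (hj : 0 < j) : R j = 1 + t * R j * (R (j - 1) + R (j + 1)) := by
  conv_lhs => rw [R_rec]
  simp [nodeWeight, not_le.2 hj]

theorem R_rec_of_nonpos {j : ℤ} (hj : j ≤ 0) : R j = u + t * R j * (R (j - 1) + R (j + 1)) := by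
  conv_lhs => rw [R_rec]
  simp [nodeWeight, hj, u]

theorem map_eval_one_R (j : ℤ) : PowerSeries.map (Polynomial.evalRingHom (1 : ℚ)) (R j) = T := by
  ext n
  rw [PowerSeries.coeff_map, R, T, PowerSeries.coeff_mk, PowerSeries.coeff_mk, map_sum]
  simp

theorem T_rec : T = 1 + 2 * PowerSeries.X * T ^ 2 := by
  have h := congrArg (PowerSeries.map (Polynomial.evalRingHom (1 : ℚ))) (R_rec_of_pos one_pos)
  simp only [map_add, map_mul, map_one, map_eval_one_R, t, PowerSeries.map_X] at h
  linear_combination h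

-- `X`-adic contractions and the conserved quantity

section Contraction

variable {A : Type*} [CommRing A]

theorem eq_of_forall_X_pow_dvd_sub {f g : A⟦X⟧} (h : ∀ n, PowerSeries.X ^ n ∣ f - g) : f = g := by
  rw [← sub_eq_zero]
  ext n
  exact PowerSeries.X_pow_dvd_iff.1 (h (n + 1)) n n.lt_succ_self

/-- Each application of `Φ` gains a factor `X` in the difference of the two fixed points, so every
power of `X` divides it. -/
theorem eq_of_fixed_of_contraction {Φ : A⟦X⟧ → A⟦X⟧}
    (h : ∀ f g, PowerSeries.X * (f - g) ∣ Φ f - Φ g) {f g : A⟦X⟧} (hf : Φ f = f) (hg : Φ g = g) :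
    f = g := by
  refine eq_of_forall_X_pow_dvd_sub fun n => ?_
  induction n with
  | zero => simp
  | succ n ih =>
    have := h f g
    rw [hf, hg] at this
    rw [pow_succ']
    exact (mul_dvd_mul_left _ ih).trans this

theorem exists_fixed_of_contraction {Φ : A⟦X⟧ → A⟦X⟧}
    (h : ∀ f g, PowerSeries.X * (f - g) ∣ Φ f - Φ g) : ∃ f, Φ f = f := by
  have step : ∀ n f g, PowerSeries.X ^ n ∣ f - g → PowerSeries.X ^ (n + 1) ∣ Φ f - Φ g := by
    intro n f g hfg
    rw [pow_succ']
    exact (mul_dvd_mul_left _ hfg).trans (h f g)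
  have h1 : ∀ n, PowerSeries.X ^ n ∣ Φ^[n + 1] 0 - Φ^[n] 0 := by
    intro n
    induction n with
    | zero => simp
    | succ n ih =>
      have := step n _ _ ih
      rwa [← Function.iterate_succ_apply' Φ, ← Function.iterate_succ_apply' Φ] at this
  have h2 : ∀ m n, PowerSeries.X ^ m ∣ Φ^[m + n] 0 - Φ^[m] 0 := by
    intro m n
    induction n with
    | zero => simp
    | succ n ih =>
      have := dvd_add ((pow_dvd_pow _ (Nat.le_add_right m n)).trans (h1 (m + n))) ih
      rwa [sub_add_sub_cancel] at this
  -- From the iterate `n + 1` on, the coefficient of index `n` no longer changes.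
  let f : A⟦X⟧ := PowerSeries.mk fun n => PowerSeries.coeff n (Φ^[n + 1] 0)
  have hf : ∀ n, PowerSeries.X ^ n ∣ f - Φ^[n] 0 := by
    intro n
    rw [PowerSeries.X_pow_dvd_iff]
    intro m hm
    obtain ⟨k, rfl⟩ := Nat.exists_eq_add_of_le (Nat.succ_le_of_lt hm)
    have := PowerSeries.X_pow_dvd_iff.1 (h2 (m + 1) k) m m.lt_succ_self
    rw [map_sub, sub_eq_zero] at this
    rw [map_sub, PowerSeries.coeff_mk, ← this, sub_self]
  refine ⟨f, eq_of_forall_X_pow_dvd_sub fun n => ?_⟩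
  have a1 := step n _ _ (hf n)
  rw [← Function.iterate_succ_apply' Φ] at a1
  have a2 := dvd_sub a1 (hf (n + 1))
  rw [sub_sub_sub_cancel_right] at a2
  exact (pow_dvd_pow _ n.le_succ).trans a2

/-- With `s = 2 + X f` the equation becomes `f = (D - X f^2) / 4`, a contraction; `c` only serves to
provide `1/4` in `A`. -/
theorem exists_sq_eq_add_X_mul (c : ℚ →+* A) (D : A⟦X⟧) :
    ∃ s : A⟦X⟧, PowerSeries.constantCoeff s = 2 ∧ s ^ 2 = 4 + PowerSeries.X * D := by
  obtain ⟨f, hf⟩ := exists_fixed_of_contraction (A := A)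
    (Φ := fun f => PowerSeries.C (c (1 / 4)) * (D - PowerSeries.X * f ^ 2))
    (fun f g => ⟨-PowerSeries.C (c (1 / 4)) * (f + g), by ring⟩)
  have h4 : PowerSeries.C (c (1 / 4)) * 4 = (1 : A⟦X⟧) := by
    have : (4 : A⟦X⟧) = PowerSeries.C (c 4) := by rw [map_ofNat, map_ofNat]
    rw [this, ← map_mul, ← map_mul]; norm_num
  refine ⟨2 + PowerSeries.X * f, by simp [map_ofNat], ?_⟩
  linear_combination (-4 * PowerSeries.X) * hf + PowerSeries.X * (D - PowerSeries.X * f ^ 2) * h4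

/-- The quantity conserved by the recursion `y = a + t y (x + z)`. -/
def invariant (a x y : A⟦X⟧) : A⟦X⟧ :=
  x * y * (1 - PowerSeries.X * x) * (1 - PowerSeries.X * y) + a * (PowerSeries.X * x * y - x - y)

/-- The increment of the invariant has the recursion as a factor, and `r n` agrees with `W` modulo
`X^n`. Only the indices `≥ 1` need satisfy the recursion; `r 0` may lie across the change of weight.
-/
theorem invariant_eq_limit {a W : A⟦X⟧} {r : ℕ → A⟦X⟧}
    (hr : ∀ n, r (n + 1) = a + PowerSeries.X * r (n + 1) * (r n + r (n + 2)))
    (hW : W = a + 2 * PowerSeries.X * W ^ 2) : invariant a (r 0) (r 1) = invariant a W W := by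
  have hconst : ∀ n, invariant a (r 0) (r 1) = invariant a (r n) (r (n + 1)) := by
    intro n
    induction n with
    | zero => rfl
    | succ n ih =>
      rw [ih, invariant, invariant]
      linear_combination (r n - r (n + 2)) * (1 - PowerSeries.X * r (n + 1)) * hr n
  have hdvd : ∀ n j, n ≤ j → PowerSeries.X ^ n ∣ r j - W := by
    intro n
    induction n with
    | zero => simp
    | succ n ih =>
      intro j hj
      obtain ⟨j, rfl⟩ : ∃ k, j = k + 1 := ⟨j - 1, by omega⟩
      have e : r (j + 1) - W = PowerSeries.X * ((r (j + 1) - W) * (r j + r (j + 2)) +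
          W * ((r j - W) + (r (j + 2) - W))) := by
        linear_combination hr j - hW
      rw [e, pow_succ']
      exact mul_dvd_mul_left _ (dvd_add ((ih (j + 1) (by omega)).mul_right _)
        ((dvd_add (ih j (by omega)) (ih (j + 2) (by omega))).mul_left _))
  refine eq_of_forall_X_pow_dvd_sub fun n => ?_
  rw [hconst n]
  have e : invariant a (r n) (r (n + 1)) - invariant a W W =
      (r n - W) * (r (n + 1) * (1 - PowerSeries.X * r (n + 1)) *
        (1 - PowerSeries.X * (r n + W)) + a * (PowerSeries.X * r (n + 1) - 1)) +
      (r (n + 1) - W) * (W * (1 - PowerSeries.X * W) *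
        (1 - PowerSeries.X * (r (n + 1) + W)) + a * (PowerSeries.X * W - 1)) := by
    simp only [invariant]; ring
  rw [e]
  exact dvd_add ((hdvd n n le_rfl).mul_right _) ((hdvd n (n + 1) (by omega)).mul_right _)

/-- The differences satisfy `d (j+1) = X r (j+1) r' (j+1) (d j + d (j+2))`, so divisibility by `X^n`
for all `j` at once improves to `X^(n+1)`. Hence `r 1` need not be prescribed. -/
theorem recursion_unique {r r' : ℕ → A⟦X⟧}
    (hr : ∀ n, r (n + 1) = 1 + PowerSeries.X * r (n + 1) * (r n + r (n + 2)))
    (hr' : ∀ n, r' (n + 1) = 1 + PowerSeries.X * r' (n + 1) * (r' n + r' (n + 2)))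
    (h0 : r 0 = r' 0) (j : ℕ) : r j = r' j := by
  suffices ∀ n j, PowerSeries.X ^ n ∣ r j - r' j from
    eq_of_forall_X_pow_dvd_sub fun n => this n j
  intro n
  induction n with
  | zero => simp
  | succ n ih =>
    intro j
    cases j with
    | zero => simp [h0]
    | succ j =>
      have e : r (j + 1) - r' (j + 1) = PowerSeries.X * (r (j + 1) * r' (j + 1) *
          ((r j - r' j) + (r (j + 2) - r' (j + 2)))) := by
        linear_combination (r' (j + 1)) * hr j - r (j + 1) * hr' j
      rw [e, pow_succ']
      exact mul_dvd_mul_left _ ((dvd_add (ih j) (ih (j + 2))).mul_left _)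

end Contraction

/-! ### The series `T`, `T(tu)` and `Z` -/

theorem exists_isZ : ∃ Z : ℚ⟦X⟧, PowerSeries.X ∣ Z ∧
    Z * (1 + Z ^ 2) = PowerSeries.X * (1 + Z) ^ 4 := by
  -- The equation of `Z` after substituting `Z = X f` and dividing by `X`.
  obtain ⟨f, hf⟩ := exists_fixed_of_contraction (A := ℚ)
    (Φ := fun f => (1 + PowerSeries.X * f) ^ 4 - PowerSeries.X ^ 2 * f ^ 3)
    (fun f g => ⟨(2 + PowerSeries.X * f + PowerSeries.X * g) *
      ((1 + PowerSeries.X * f) ^ 2 + (1 + PowerSeries.X * g) ^ 2) -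
      PowerSeries.X * (f ^ 2 + f * g + g ^ 2), by ring⟩)
  exact ⟨PowerSeries.X * f, ⟨f, rfl⟩, by linear_combination -PowerSeries.X * hf⟩

theorem isZ_iff {Z : ℚ⟦X⟧} :
    IsZ Z ↔ PowerSeries.X ∣ Z ∧ Z * (1 + Z ^ 2) = PowerSeries.X * (1 + Z) ^ 4 := by
  rw [IsZ, PowerSeries.X_dvd_iff]
  refine and_congr_right fun h0 => ?_
  rw [PowerSeries.eq_mul_inv_iff_mul_eq]
  simp [h0]

theorem isZ_unique {Z Z' : ℚ⟦X⟧} (h : IsZ Z) (h' : IsZ Z') : Z' = Z := by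
  rw [isZ_iff] at h h'
  obtain ⟨⟨f, rfl⟩, hf⟩ := h
  obtain ⟨⟨g, rfl⟩, hg⟩ := h'
  congr 1
  refine eq_of_fixed_of_contraction (A := ℚ)
    (Φ := fun f => (1 + PowerSeries.X * f) ^ 4 - PowerSeries.X ^ 2 * f ^ 3)
    (fun f g => ⟨(2 + PowerSeries.X * f + PowerSeries.X * g) *
      ((1 + PowerSeries.X * f) ^ 2 + (1 + PowerSeries.X * g) ^ 2) -
      PowerSeries.X * (f ^ 2 + f * g + g ^ 2), by ring⟩) ?_ ?_
  · refine mul_left_cancel₀ PowerSeries.X_ne_zero (?_ : PowerSeries.X * _ = PowerSeries.X * _)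
    linear_combination -hg
  · refine mul_left_cancel₀ PowerSeries.X_ne_zero (?_ : PowerSeries.X * _ = PowerSeries.X * _)
    linear_combination -hf

/-- The series `(1 + Z)^2 / (1 + Z^2)` satisfies the quadratic equation that characterizes `T`. -/
theorem T_mul_one_add_sq {Z : ℚ⟦X⟧} (h0 : PowerSeries.X ∣ Z)
    (h : Z * (1 + Z ^ 2) = PowerSeries.X * (1 + Z) ^ 4) : T * (1 + Z ^ 2) = (1 + Z) ^ 2 := by
  have hc : PowerSeries.constantCoeff (1 + Z ^ 2) ≠ 0 := by
    simp [PowerSeries.X_dvd_iff.1 h0]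
  rw [← PowerSeries.eq_mul_inv_iff_mul_eq hc]
  have hi := PowerSeries.mul_inv_cancel _ hc
  refine eq_of_fixed_of_contraction (A := ℚ) (Φ := fun f => 1 + 2 * PowerSeries.X * f ^ 2)
    (fun f g => ⟨2 * (f + g), by ring⟩) T_rec.symm ?_
  generalize (1 + Z ^ 2)⁻¹ = i at hi
  have e : 1 + 2 * PowerSeries.X * ((1 + Z) ^ 2 * i) ^ 2 =
      1 + 2 * (PowerSeries.X * (1 + Z) ^ 4) * i ^ 2 := by ring
  show 1 + 2 * PowerSeries.X * ((1 + Z) ^ 2 * i) ^ 2 = _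
  rw [e, ← h]
  linear_combination (2 * Z * i - 1) * hi

theorem constU_T_rec : constU T = 1 + 2 * t * constU T ^ 2 := by
  have := congrArg constU T_rec
  simp only [constU, map_add, map_mul, map_one, map_pow, PowerSeries.map_X, map_ofNat] at this
  rw [constU, t]
  linear_combination this

theorem atTU_T_rec : atTU T = 1 + 2 * t * u * atTU T ^ 2 := by
  have := congrArg atTU T_rec
  simp only [atTU, constU, map_add, map_mul, map_one, map_pow, PowerSeries.map_X,
    PowerSeries.rescale_X, map_ofNat] at this
  rw [atTU, constU, t, u]
  linear_combination this

theorem invariant_R_top :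
    invariant 1 (R 0) (R 1) = invariant 1 (constU T) (constU T) := by
  have h := invariant_eq_limit (a := 1) (r := fun n : ℕ => R n) (fun n => by
    have := R_rec_of_pos (j := n + 1) (by omega)
    rw [add_sub_cancel_right, add_assoc] at this
    push_cast
    exact this) constU_T_rec
  simpa only [Nat.cast_zero, Nat.cast_one] using h

/-- The sequence is read downwards from `R 1`, whose own weight is not `u` but which is only needed
as the free term `r 0`. The limit `u T(tu)` counts the trees with every node weighted `u`. -/
theorem invariant_R_bot :
    invariant u (R 1) (R 0) = invariant u (u * atTU T) (u * atTU T) := by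
  have hW : u * atTU T = u + 2 * PowerSeries.X * (u * atTU T) ^ 2 := by
    have := atTU_T_rec
    rw [t] at this
    linear_combination u * this
  have h := invariant_eq_limit (r := fun n : ℕ => R (1 - n)) (fun n => by
    have := R_rec_of_nonpos (j := 1 - (n + 1)) (by omega)
    rw [show (1 : ℤ) - (n + 1) - 1 = 1 - (n + 2) by ring,
      show (1 : ℤ) - (n + 1) + 1 = 1 - n by ring, add_comm (R _) (R _)] at this
    push_cast
    exact this) hW
  simpa only [Nat.cast_zero, Nat.cast_one, sub_zero, sub_self] using h

theorem constantCoeff_T : PowerSeries.constantCoeff T = 1 := by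
  rw [T_rec]; simp

theorem constantCoeff_R_of_pos {j : ℤ} (hj : 0 < j) : PowerSeries.constantCoeff (R j) = 1 := by
  rw [R_rec_of_pos hj]; simp [t]

theorem constantCoeff_R_of_nonpos {j : ℤ} (hj : j ≤ 0) :
    PowerSeries.constantCoeff (R j) = Polynomial.X := by
  rw [R_rec_of_nonpos hj]; simp [t, u]

/-- The discriminant whose square root generates the extension containing all the `R_j`. -/
def disc {A : Type*} [CommRing A] (T V : A) : A := (T + V) ^ 2 - 4 * T * V * (T - 1) * (V - 1)

/-! Polynomials in `T` and `V` occurring in the expressions of `R_0` and `R_1`. -/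

section Polynomials

variable {A : Type*} [CommRing A] (T V : A)

/-- The denominator of the conserved quantity. -/
def polyB : A := T * V - T - V

/-- The denominator of the product `R_0 R_1`. -/
def polyD : A :=
  (T + V) * (T ^ 2 + V ^ 2) + 2 * T * V * (T ^ 2 + T * V + V ^ 2) - 2 * T ^ 3 * V ^ 3

/-- The numerator of the conserved quantity. -/
def polyN : A :=
  -V ^ 3 - T * V ^ 2 - 2 * T * V ^ 3 - T ^ 2 * V - 2 * T ^ 2 * V ^ 2 + 8 * T ^ 2 * V ^ 3 - T ^ 3
    - 2 * T ^ 3 * V + 8 * T ^ 3 * V ^ 2 - 6 * T ^ 3 * V ^ 3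

/-- The numerator of the product `R_0 R_1`. -/
def polyQ : A := T + V + 3 * T * V - T ^ 2 * V ^ 2

/-- The square factor of the discriminant of `R_0`. -/
def polyY : A :=
  (T + V) ^ 4 + 2 * T * V * (T + V) ^ 3 - 4 * T ^ 2 * V ^ 2 * (T ^ 2 + T * V + V ^ 2)
    - 4 * T ^ 3 * V ^ 3 * (T + V) + 4 * T ^ 4 * V ^ 4

end Polynomials

-- The algebraic system over an arbitrary field

/-- The algebraic relations between `t`, `u`, `Z`, `T = T(t)`, `V = T(tu)`, `x = R_0`, `y = R_1`
and `ν`. -/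
structure Rel {F : Type*} [Field F] (t u Z T V x y ν : F) : Prop where
  hZ : Z * (1 + Z ^ 2) = t * (1 + Z) ^ 4
  hT : T * (1 + Z ^ 2) = (1 + Z) ^ 2
  hTt : T = 1 + 2 * t * T ^ 2
  hV : V = 1 + 2 * t * u * V ^ 2
  hI : x * y * (1 - t * x) * (1 - t * y) + (t * x * y - x - y) =
    T * T * (1 - t * T) * (1 - t * T) + (t * T * T - T - T)
  hJ : x * y * (1 - t * x) * (1 - t * y) + u * (t * x * y - x - y) =
    u * V * (u * V) * (1 - t * (u * V)) * (1 - t * (u * V)) +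
      u * (t * (u * V) * (u * V) - u * V - u * V)
  hx : x * ((1 + ν * Z) * (1 + ν * Z ^ 3)) = T * ((1 + ν) * (1 + ν * Z ^ 4))
  hy : y * ((1 + ν * Z ^ 2) * (1 + ν * Z ^ 4)) = T * ((1 + ν * Z) * (1 + ν * Z ^ 5))
  t_ne : t ≠ 0
  u_ne : u ≠ 0
  u_ne_one : u ≠ 1
  disc_u_ne : 1 - 8 * t * u ≠ 0
  Z_sq : 1 + Z ^ 2 ≠ 0
  Z_ne_neg : 1 + Z ≠ 0
  Z_ne_one : 1 - Z ≠ 0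
  Z_cube : 1 - Z ^ 3 ≠ 0
  ν_ne : ν ≠ 0
  den1 : 1 + ν * Z ≠ 0
  den2 : 1 + ν * Z ^ 2 ≠ 0
  den3 : 1 + ν * Z ^ 3 ≠ 0
  den4 : 1 + ν * Z ^ 4 ≠ 0
  -- This is the leading coefficient of `disc` as a polynomial in `V`. The polynomials `polyB`,
  -- `polyD`, `polyY` are divided by when solving for `x + y`, `xy` and `√disc`.
  lead_ne : 1 - 4 * T * (T - 1) ≠ 0
  B_ne : polyB T V ≠ 0
  D_ne : polyD T V ≠ 0
  Y_ne : polyY T V ≠ 0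

/-- Polynomial equations and inequations are preserved and reflected by field embeddings. In
`exists_conjugate` the relations are thus restricted to a subfield and then moved along another
embedding of it. -/
theorem Rel.map_iff {F G : Type*} [Field F] [Field G] (f : F →+* G) {t u Z T V x y ν : F} :
    Rel (f t) (f u) (f Z) (f T) (f V) (f x) (f y) (f ν) ↔ Rel t u Z T V x y ν := by
  have key : ∀ a b : F, f a = f b ↔ a = b := fun a b => f.injective.eq_iff
  constructor
  · rintro ⟨h1, h2, h3, h4, h5, h6, h7, h8, h9, h10, h11, h12, h13, h14, h15, h16, h17, h18, h19,
      h20, h21, h22, h23, h24,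
      h25⟩
    constructor
    all_goals first
      | (rw [← key]; simp only [map_add, map_sub, map_mul, map_pow, map_one, map_ofNat]; assumption)
      | (rw [Ne, ← key]
         simp only [polyB, polyD, polyY, map_add, map_sub, map_mul, map_pow, map_one, map_ofNat, map_zero]; assumption)
  · rintro ⟨h1, h2, h3, h4, h5, h6, h7, h8, h9, h10, h11, h12, h13, h14, h15, h16, h17, h18, h19,
      h20, h21, h22, h23, h24,
      h25⟩
    rw [← key] at h1 h2 h3 h4 h5 h6 h7 h8
    rw [Ne, ← key] at h9 h10 h11 h12 h13 h14 h15 h16 h17 h18 h19 h20 h21 h22 h23 h24 h25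
    simp only [polyB, polyD, polyY, map_add, map_sub, map_mul, map_pow, map_one, map_ofNat, map_zero] at *
    constructor <;> assumption

theorem subfieldSubtype_mem {F : Type*} [Field F] (E : Subfield F) (a : E) : E.subtype a ∈ E :=
  a.2

set_option linter.unusedSectionVars false

-- Elimination: symmetric functions of `R_0` and `R_1`

namespace Rel

variable {F : Type*} [Field F] [CharZero F] {t u Z T V x y ν : F} (h : Rel t u Z T V x y ν)

include h

theorem T_ne : T ≠ 0 := by
  rintro rfl
  simpa using h.hTt

theorem V_ne : V ≠ 0 := by
  rintro rfl
  simpa using h.hV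

theorem T_sub_one_ne : T - 1 ≠ 0 := by
  have : T - 1 = 2 * t * T ^ 2 := by linear_combination h.hTt
  rw [this]
  exact mul_ne_zero (mul_ne_zero two_ne_zero h.t_ne) (pow_ne_zero _ h.T_ne)

theorem t_eq : t = (T - 1) / (2 * T ^ 2) := by
  have := h.T_ne
  rw [eq_div_iff (mul_ne_zero two_ne_zero (pow_ne_zero _ this))]
  linear_combination -h.hTt

theorem u_eq : u = T ^ 2 * (V - 1) / (V ^ 2 * (T - 1)) := by
  have h1 := h.V_ne
  have h2 := h.T_sub_one_ne
  rw [eq_div_iff (mul_ne_zero (pow_ne_zero _ h1) h2)]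
  linear_combination u * V ^ 2 * h.hTt - T ^ 2 * h.hV

theorem T_sub_V_ne : T - V ≠ 0 := by
  intro h0
  obtain rfl : T = V := sub_eq_zero.1 h0
  apply h.u_ne_one
  have h1 := h.T_ne
  have h2 := h.T_sub_one_ne
  have := h.u_eq
  field_simp at this
  exact this

theorem Z_ne : Z ≠ 0 := by
  rintro rfl
  have := h.hZ
  simp at this
  exact h.t_ne this.symm

/-- The difference of `hJ` and `hI` loses the quartic term and is linear in `txy - x - y`; then `u`
is replaced by its expression in `T` and `V`. The factor `T - V`, nonzero as `u ≠ 1`, cancels. -/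
theorem conserved_eq :
    (t * x * y - x - y) * (4 * V ^ 2 * (T - 1) * polyB T V) = polyN T V := by
  have hU : V ^ 2 * (T - 1) * u = T ^ 2 * (V - 1) := by
    linear_combination u * V ^ 2 * h.hTt - T ^ 2 * h.hV
  have hJI : (u - 1) * (t * x * y - x - y) * 4 =
      u ^ 2 * (V ^ 2 - 4 * V - 1) - (T ^ 2 - 4 * T - 1) := by
    linear_combination 4 * (h.hJ - h.hI) + u ^ 2 * (3 * V - 1 - 2 * t * u * V ^ 2) * h.hV -
      (3 * T - 1 - 2 * t * T ^ 2) * h.hTt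
  refine mul_left_cancel₀ h.T_sub_V_ne ?_
  rw [polyB, polyN]
  linear_combination V ^ 4 * (T - 1) ^ 2 * hJI - 4 * V ^ 2 * (T - 1) * (t * x * y - x - y) * hU +
    (V ^ 2 - 4 * V - 1) * (V ^ 2 * (T - 1) * u + T ^ 2 * (V - 1)) * hU

/-- With `c = txy - x - y`, the relation `hI` reads `xy (1 + tc) + c =` constant, which is linear in
`xy` once `c` is known. -/
theorem prod_eq :
    x * y * ((T - 1) * polyD T V) = 2 * T ^ 4 * (V - 1) * polyQ T V := by
  have hc := h.conserved_eq
  have hp : 4 * (x * y) * (1 + t * (t * x * y - x - y)) + 4 * (t * x * y - x - y) =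
      T ^ 2 - 4 * T - 1 := by
    linear_combination 4 * h.hI + (3 * T - 1 - 2 * t * T ^ 2) * h.hTt
  generalize t * x * y - x - y = c at *
  generalize x * y = p at *
  generalize hn : polyN T V = n at *
  rw [polyB] at hc
  rw [polyN] at hn
  rw [polyD, polyQ]
  linear_combination (-T ^ 2 * (4 * V ^ 2 * (T - 1) * (T * V - T - V)) / 2) * hp +
    2 * T ^ 2 * (p * t + 1) * hc - p * n * h.hTt - (p * (T - 1) + 2 * T ^ 2) * hn

theorem add_eq :
    (x + y) * (8 * V ^ 2 * (T - 1) * polyB T V * polyD T V) =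
      8 * V ^ 2 * T ^ 2 * (T - 1) * (V - 1) * polyB T V * polyQ T V -
        2 * polyD T V * polyN T V := by
  have hp := h.prod_eq
  have hT := h.hTt
  linear_combination (-2 * polyD T V) * h.conserved_eq + 8 * V ^ 2 * polyB T V * t * hp -
    8 * V ^ 2 * polyB T V * T ^ 2 * (V - 1) * polyQ T V * hT

/-- This is `(x + y)^2 - 4xy` with both terms known; the resulting polynomial in `T, V` factors as a
square times `disc`. -/
theorem sub_sq_eq :
    ((x - y) * (4 * V ^ 2 * (T - 1) * polyB T V * polyD T V)) ^ 2 =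
      ((T - V) * polyY T V) ^ 2 * disc T V := by
  have hp := h.prod_eq
  have hs := h.add_eq
  have key : (8 * V ^ 2 * T ^ 2 * (T - 1) * (V - 1) * polyB T V * polyQ T V -
        2 * polyD T V * polyN T V) ^ 2 -
      512 * V ^ 4 * (T - 1) * polyB T V ^ 2 * polyD T V * T ^ 4 * (V - 1) * polyQ T V =
      4 * (((T - V) * polyY T V) ^ 2 * disc T V) := by
    simp only [polyB, polyD, polyN, polyQ, polyY, disc]
    ring
  generalize polyB T V = b at *
  generalize polyD T V = d at *
  generalize polyN T V = n at *
  generalize polyQ T V = q at *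
  linear_combination (1 / 4) * ((x + y) * (8 * V ^ 2 * (T - 1) * b * d) +
      (8 * V ^ 2 * T ^ 2 * (T - 1) * (V - 1) * b * q - 2 * d * n)) * hs -
    64 * V ^ 4 * (T - 1) * b ^ 2 * d * hp + (1 / 4) * key

-- Which elements generate which others

section Subfield

variable {E : Subfield F}

theorem t_mem (hT : T ∈ E) : t ∈ E := by
  rw [h.t_eq]
  exact div_mem (sub_mem hT (one_mem _)) (mul_mem (ofNat_mem _ 2) (pow_mem hT _))

theorem u_mem (hT : T ∈ E) (hV : V ∈ E) : u ∈ E := by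
  rw [h.u_eq]
  exact div_mem (mul_mem (pow_mem hT _) (sub_mem hV (one_mem _)))
    (mul_mem (pow_mem hV _) (sub_mem hT (one_mem _)))

theorem T_mem (hZ : Z ∈ E) : T ∈ E := by
  rw [eq_div_of_mul_eq h.Z_sq h.hT]
  exact div_mem (pow_mem (add_mem (one_mem _) hZ) _) (add_mem (one_mem _) (pow_mem hZ _))

theorem prod_mem (hT : T ∈ E) (hV : V ∈ E) : x * y ∈ E := by
  rw [eq_div_of_mul_eq (mul_ne_zero h.T_sub_one_ne h.D_ne) h.prod_eq]
  have h1 : T - 1 ∈ E := sub_mem hT (one_mem _)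
  let T' : E := ⟨T, hT⟩
  let V' : E := ⟨V, hV⟩
  have h2 : E.subtype (2 * T' ^ 4 * (V' - 1) * polyQ T' V') ∈ E := subfieldSubtype_mem E _
  have h3 : E.subtype (polyD T' V') ∈ E := subfieldSubtype_mem E _
  simp only [polyQ, polyD, map_mul, map_add, map_sub,
    map_pow, map_one, map_ofNat, Subfield.subtype_apply, T', V'] at h2 h3
  exact div_mem h2 (mul_mem h1 h3)

theorem sum_mem (hT : T ∈ E) (hV : V ∈ E) : x + y ∈ E := by
  rw [eq_div_of_mul_eq (mul_ne_zero (mul_ne_zero (mul_ne_zero (mul_ne_zero (by norm_num)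
    (pow_ne_zero _ h.V_ne)) h.T_sub_one_ne) h.B_ne) h.D_ne) h.add_eq]
  let T' : E := ⟨T, hT⟩
  let V' : E := ⟨V, hV⟩
  have h2 : E.subtype (8 * V' ^ 2 * T' ^ 2 * (T' - 1) * (V' - 1) * polyB T' V' * polyQ T' V' -
        2 * polyD T' V' * polyN T' V') ∈ E := subfieldSubtype_mem E _
  have h3 : E.subtype (8 * V' ^ 2 * (T' - 1) * polyB T' V' * polyD T' V') ∈ E := subfieldSubtype_mem E _
  simp only [polyQ, polyD, polyN, polyB, map_mul, map_add, map_sub,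
    map_neg, map_pow, map_one, map_ofNat, Subfield.subtype_apply, T', V'] at h2 h3
  exact div_mem h2 h3

theorem polyM_mem (hT : T ∈ E) (hV : V ∈ E) :
    4 * V ^ 2 * (T - 1) * polyB T V * polyD T V ∈ E := by
  let T' : E := ⟨T, hT⟩
  let V' : E := ⟨V, hV⟩
  have h3 : E.subtype (4 * V' ^ 2 * (T' - 1) * polyB T' V' * polyD T' V') ∈ E := subfieldSubtype_mem E _
  simp only [polyD, polyB, map_mul, map_add, map_sub,
    map_pow, map_one, map_ofNat, Subfield.subtype_apply, T', V'] at h3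
  exact h3

theorem polyAY_mem (hT : T ∈ E) (hV : V ∈ E) : (T - V) * polyY T V ∈ E := by
  let T' : E := ⟨T, hT⟩
  let V' : E := ⟨V, hV⟩
  have h3 : E.subtype ((T' - V') * polyY T' V') ∈ E := subfieldSubtype_mem E _
  simp only [polyY, map_mul, map_add, map_sub,
    map_pow, map_ofNat, Subfield.subtype_apply, T', V'] at h3
  exact h3

theorem polyM_ne : 4 * V ^ 2 * (T - 1) * polyB T V * polyD T V ≠ 0 :=
  mul_ne_zero (mul_ne_zero (mul_ne_zero (mul_ne_zero (by norm_num)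
    (pow_ne_zero _ h.V_ne)) h.T_sub_one_ne) h.B_ne) h.D_ne

theorem polyAY_ne : (T - V) * polyY T V ≠ 0 := mul_ne_zero h.T_sub_V_ne h.Y_ne

theorem exists_sq_eq_disc (hT : T ∈ E) (hV : V ∈ E) (hx : x ∈ E) (hy : y ∈ E) :
    ∃ δ ∈ E, δ ^ 2 = disc T V := by
  refine ⟨(x - y) * (4 * V ^ 2 * (T - 1) * polyB T V * polyD T V) / ((T - V) * polyY T V),
    div_mem (mul_mem (sub_mem hx hy) (h.polyM_mem hT hV)) (h.polyAY_mem hT hV), ?_⟩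
  rw [div_pow, h.sub_sq_eq, mul_div_cancel_left₀ _ (pow_ne_zero _ h.polyAY_ne)]

theorem mem_of_sq_eq_disc (hT : T ∈ E) (hV : V ∈ E) {δ : F} (hδ : δ ∈ E)
    (hδ2 : δ ^ 2 = disc T V) : x ∈ E ∧ y ∈ E := by
  have hm : x - y ∈ E := by
    have := h.sub_sq_eq
    rw [← hδ2, ← mul_pow, sq_eq_sq_iff_eq_or_eq_neg] at this
    have hδ' := mul_mem (h.polyAY_mem hT hV) hδ
    rcases this with this | this
    · rw [eq_div_of_mul_eq h.polyM_ne this]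
      exact div_mem hδ' (h.polyM_mem hT hV)
    · rw [eq_div_of_mul_eq h.polyM_ne this]
      exact div_mem (neg_mem hδ') (h.polyM_mem hT hV)
  have hs := h.sum_mem hT hV
  constructor
  · rw [show x = ((x + y) + (x - y)) / 2 by ring]
    exact div_mem (add_mem hs hm) (ofNat_mem _ 2)
  · rw [show y = ((x + y) - (x - y)) / 2 by ring]
    exact div_mem (sub_mem hs hm) (ofNat_mem _ 2)

theorem one_add_mem {a b : F} (n : ℕ) (ha : a ∈ E) (hb : b ∈ E) : 1 + a * b ^ n ∈ E :=
  add_mem (one_mem _) (mul_mem ha (pow_mem hb _))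

theorem x_mem (hZ : Z ∈ E) (hν : ν ∈ E) : x ∈ E := by
  rw [eq_div_of_mul_eq (mul_ne_zero h.den1 h.den3) h.hx]
  exact div_mem (mul_mem (h.T_mem hZ) (mul_mem (add_mem (one_mem _) hν)
    (h.one_add_mem _ hν hZ))) (mul_mem (add_mem (one_mem _) (mul_mem hν hZ))
    (h.one_add_mem _ hν hZ))

theorem y_mem (hZ : Z ∈ E) (hν : ν ∈ E) : y ∈ E := by
  rw [eq_div_of_mul_eq (mul_ne_zero h.den2 h.den4) h.hy]
  exact div_mem (mul_mem (h.T_mem hZ) (mul_mem (add_mem (one_mem _) (mul_mem hν hZ))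
    (h.one_add_mem _ hν hZ))) (mul_mem (h.one_add_mem _ hν hZ) (h.one_add_mem _ hν hZ))

/-- The difference of the two invariants is a second quadratic equation for `V`. Eliminating `V^2`
with `hV` leaves a linear one, with leading coefficient `u (1 - 8tu)`. -/
theorem V_mem (hZ : Z ∈ E) (hu : u ∈ E) (hν : ν ∈ E) : V ∈ E := by
  have hT := h.T_mem hZ
  have ht := h.t_mem hT
  have hx := h.x_mem hZ hν
  have hy := h.y_mem hZ hν
  have hJI : (u - 1) * (t * x * y - x - y) * 4 =
      u ^ 2 * (V ^ 2 - 4 * V - 1) - (T ^ 2 - 4 * T - 1) := by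
    linear_combination 4 * (h.hJ - h.hI) + u ^ 2 * (3 * V - 1 - 2 * t * u * V ^ 2) * h.hV -
      (3 * T - 1 - 2 * t * T ^ 2) * h.hTt
  have e : V * (u * (1 - 8 * t * u)) = u + 2 * t * u ^ 2 + 2 * t * (T ^ 2 - 4 * T - 1) +
      8 * t * (u - 1) * (t * x * y - x - y) := by
    linear_combination u * h.hV - 2 * t * hJI
  rw [eq_div_of_mul_eq (mul_ne_zero h.u_ne h.disc_u_ne) e]
  let t' : E := ⟨t, ht⟩
  let u' : E := ⟨u, hu⟩
  let T' : E := ⟨T, hT⟩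
  let x' : E := ⟨x, hx⟩
  let y' : E := ⟨y, hy⟩
  have h2 : E.subtype (u' + 2 * t' * u' ^ 2 + 2 * t' * (T' ^ 2 - 4 * T' - 1) +
      8 * t' * (u' - 1) * (t' * x' * y' - x' - y')) ∈ E := subfieldSubtype_mem E _
  have h3 : E.subtype (u' * (1 - 8 * t' * u')) ∈ E := subfieldSubtype_mem E _
  simp only [map_mul, map_add, map_sub,
    map_pow, map_one, map_ofNat, Subfield.subtype_apply, t', u', T', x', y'] at h2 h3
  exact div_mem h2 h3

/-- In the product `xy` most factors cancel: `xy = T^2 (1+ν)(1+νZ^5) / ((1+νZ^2)(1+νZ^3))`.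
Numerator and denominator both have the form `Z^5 ν^2 + 1 + (…) ν`, and `xy ∈ E` by `prod_mem`. -/
theorem exists_quadratic (hZ : Z ∈ E) (hV : V ∈ E) : ∃ w ∈ E, Z ^ 5 * ν ^ 2 + 1 = w * ν := by
  have hT := h.T_mem hZ
  have hp := h.prod_mem hT hV
  have e : x * y * (Z ^ 5 * ν ^ 2 + 1 + ν * (Z ^ 2 + Z ^ 3)) =
      T ^ 2 * (Z ^ 5 * ν ^ 2 + 1 + ν * (1 + Z ^ 5)) := by
    refine mul_right_cancel₀ (mul_ne_zero h.den1 h.den4) ?_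
    linear_combination y * ((1 + ν * Z ^ 2) * (1 + ν * Z ^ 4)) * h.hx +
      T * ((1 + ν) * (1 + ν * Z ^ 4)) * h.hy
  -- Otherwise `1 + Z^5 = Z^2 + Z^3`, that is `(1 - Z^2)(1 - Z^3) = 0`.
  have hne : x * y - T ^ 2 ≠ 0 := by
    intro h0
    have : T ^ 2 * ν * ((1 - Z) * (1 + Z) * (1 - Z ^ 3)) = 0 := by
      linear_combination (Z ^ 5 * ν ^ 2 + 1 + ν * (Z ^ 2 + Z ^ 3)) * h0 - e
    exact mul_ne_zero (mul_ne_zero (pow_ne_zero _ h.T_ne) h.ν_ne)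
      (mul_ne_zero (mul_ne_zero h.Z_ne_one h.Z_ne_neg) h.Z_cube) this
  refine ⟨(T ^ 2 * (1 + Z ^ 5) - x * y * (Z ^ 2 + Z ^ 3)) / (x * y - T ^ 2),
    div_mem (sub_mem (mul_mem (pow_mem hT _) (add_mem (one_mem _) (pow_mem hZ _)))
      (mul_mem hp (add_mem (pow_mem hZ _) (pow_mem hZ _)))) (sub_mem hp (pow_mem hT _)), ?_⟩
  rw [div_mul_eq_mul_div, eq_div_iff hne]
  linear_combination e

end Subfield

end Rel

open IntermediateField

-- Nonsquares in a simple transcendental extension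

section NonSquare

variable {k Ω : Type*} [Field k] [Field Ω] [Algebra k Ω]

/-- Writing `y = r/s` gives `r^2 = p s^2` in `k[X]`; since `k[X]` is integrally closed, `s` divides
`r`. So `p` is the square of a polynomial, which must be a unit as `p` is squarefree. -/
theorem sq_ne_aeval_of_transcendental {x : Ω} (hx : Transcendental k x) {p : k[X]}
    (hp : Squarefree p) (hu : ¬IsUnit p) {y : Ω} (hy : y ∈ k⟮x⟯) : y ^ 2 ≠ Polynomial.aeval x p := by
  intro h
  obtain ⟨r, s, rfl⟩ := (mem_adjoin_simple_iff k y).1 hy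
  have hinj := transcendental_iff_injective.1 hx
  have hp0 : Polynomial.aeval x p ≠ 0 := by
    rw [Ne, map_eq_zero_iff _ hinj]
    exact hp.ne_zero
  have hs : Polynomial.aeval x s ≠ 0 := by
    intro hs
    rw [hs, div_zero, zero_pow two_ne_zero] at h
    exact hp0 h.symm
  rw [div_pow, div_eq_iff (pow_ne_zero _ hs), ← map_pow, ← map_pow, ← map_mul] at h
  have h' : r ^ 2 = p * s ^ 2 := hinj h
  have hs0 : s ≠ 0 := by
    rintro rfl
    simp at hs
  obtain ⟨c, rfl⟩ : s ∣ r := (IsIntegrallyClosed.pow_dvd_pow_iff two_ne_zero).1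
    (Dvd.intro_left _ h'.symm)
  rw [mul_pow, mul_comm] at h'
  have h'' := mul_right_cancel₀ (pow_ne_zero 2 hs0) h'
  have hc : IsUnit c := hp c ⟨1, by rw [mul_one, ← sq, h'']⟩
  exact hu (h'' ▸ hc.pow 2)

theorem squarefree_quadratic [CharZero k] {a b c : k} (ha : a ≠ 0) (h : b ^ 2 - 4 * a * c ≠ 0) :
    Squarefree (Polynomial.C a * Polynomial.X ^ 2 + Polynomial.C b * Polynomial.X +
      Polynomial.C c) ∧ ¬IsUnit (Polynomial.C a * Polynomial.X ^ 2 +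
        Polynomial.C b * Polynomial.X + Polynomial.C c) := by
  constructor
  · refine Polynomial.Separable.squarefree ?_
    refine ⟨Polynomial.C (-4 * a / (b ^ 2 - 4 * a * c)),
      Polynomial.C (1 / (b ^ 2 - 4 * a * c)) *
        (Polynomial.C (2 * a) * Polynomial.X + Polynomial.C b), ?_⟩
    have h1 : Polynomial.C (1 / (b ^ 2 - 4 * a * c)) *
      (Polynomial.C b ^ 2 - 4 * Polynomial.C a * Polynomial.C c) = 1 := by
      rw [← map_ofNat Polynomial.C 4, ← map_pow, ← map_mul, ← map_mul, ← map_sub, ← map_mul,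
        one_div_mul_cancel h, map_one]
    have h2 : Polynomial.C (-4 * a / (b ^ 2 - 4 * a * c)) =
        -4 * Polynomial.C a * Polynomial.C (1 / (b ^ 2 - 4 * a * c)) := by
      rw [← map_ofNat Polynomial.C 4, ← map_neg, ← map_mul, ← map_mul, mul_one_div]
    have h3 : Polynomial.C (2 * a) = 2 * Polynomial.C a := by
      rw [map_mul, map_ofNat]
    simp only [Polynomial.derivative_add, Polynomial.derivative_C_mul, Polynomial.derivative_X_pow,
      Polynomial.derivative_X, Polynomial.derivative_C, h2, h3]
    simp only [Nat.cast_ofNat, Nat.add_one_sub_one, pow_one, map_ofNat]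
    linear_combination h1
  · intro hu
    have := Polynomial.natDegree_quadratic (b := b) (c := c) ha
    rw [Polynomial.natDegree_eq_zero_of_isUnit hu] at this
    omega

theorem squarefree_linear {a b : k} (ha : a ≠ 0) :
    Squarefree (Polynomial.C a * Polynomial.X + Polynomial.C b) ∧
      ¬IsUnit (Polynomial.C a * Polynomial.X + Polynomial.C b) := by
  have := Polynomial.irreducible_of_degree_eq_one (Polynomial.degree_linear (b := b) ha)
  exact ⟨this.squarefree, this.not_isUnit⟩

end NonSquare

/-- Every subfield contains `ℚ`. This passes from fields generated over `ℚ` to fields such as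
`k⟮V⟯`. -/
theorem mem_subfield_of_mem_adjoin {Ω : Type*} [Field Ω] [Algebra ℚ Ω] {S : Set Ω}
    {E : Subfield Ω} (h : S ⊆ E) {z : Ω} (hz : z ∈ adjoin ℚ S) : z ∈ E := by
  have hE : ∀ q : ℚ, algebraMap ℚ Ω q ∈ E := fun q => by
    rw [eq_ratCast]
    exact SubfieldClass.ratCast_mem E q
  exact (adjoin_le_iff (T := E.toIntermediateField hE)).2 h hz

-- `V` and `ν` are irrational over a field of constants containing `Z`

namespace Rel

section

variable {k Ω : Type*} [Field k] [Field Ω] [CharZero Ω] [Algebra k Ω] {t u Z T V x y ν : Ω}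

theorem V_notMem (h : Rel t u Z T V x y ν) (hu : Transcendental k u)
    (hZ : Z ∈ (algebraMap k Ω).fieldRange) : V ∉ k⟮u⟯ := by
  intro hV
  obtain ⟨t', ht'⟩ := h.t_mem (h.T_mem hZ)
  have ht0 : t' ≠ 0 := by
    rintro rfl
    exact h.t_ne (by rw [← ht', map_zero])
  have : CharZero k := (RingHom.charZero_iff (algebraMap k Ω).injective).2 inferInstance
  obtain ⟨h1, h2⟩ := squarefree_linear (a := -8 * t') (b := 1)
    (mul_ne_zero (by norm_num) ht0)
  have htm : t ∈ k⟮u⟯ := ht' ▸ IntermediateField.algebraMap_mem _ t'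
  -- Completing the square in `hV`: `(4tuV - 1)^2 = 1 - 8tu`, linear in `u`.
  refine sq_ne_aeval_of_transcendental hu h1 h2 (y := 4 * t * u * V - 1)
    (sub_mem (mul_mem (mul_mem (mul_mem (ofNat_mem _ 4) htm) (mem_adjoin_simple_self k u)) hV)
      (one_mem _)) ?_
  simp only [map_add, map_mul, Polynomial.aeval_C, Polynomial.aeval_X, map_neg, map_ofNat, map_one,
    ht']
  linear_combination (-8 * t * u) * h.hV

theorem V_transcendental (h : Rel t u Z T V x y ν) (hu : Transcendental k u)
    (hZ : Z ∈ (algebraMap k Ω).fieldRange) : Transcendental k V := by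
  intro hV
  obtain ⟨T', hT'⟩ := h.T_mem hZ
  have hTm : T ∈ (algebraicClosure k Ω).toSubfield := hT' ▸ IntermediateField.algebraMap_mem _ T'
  exact hu (mem_algebraicClosure_iff.1
    (h.u_mem (E := (algebraicClosure k Ω).toSubfield) hTm (mem_algebraicClosure_iff.2 hV)))

/-- If `ν` were in `k⟮V⟯`, so would be `x` and `y`, hence a square root of `disc`. But `disc` is
quadratic in `V` with coefficients in `k` and discriminant `32 T^3 (T - 1) ≠ 0`. -/
theorem ν_notMem (h : Rel t u Z T V x y ν) (hu : Transcendental k u)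
    (hZ : Z ∈ (algebraMap k Ω).fieldRange) : ν ∉ k⟮V⟯ := by
  intro hν
  obtain ⟨T', hT'⟩ := h.T_mem hZ
  obtain ⟨Z', hZ'⟩ := hZ
  have hTm : T ∈ k⟮V⟯.toSubfield := hT' ▸ IntermediateField.algebraMap_mem _ T'
  have hZm : Z ∈ k⟮V⟯.toSubfield := hZ' ▸ IntermediateField.algebraMap_mem _ Z'
  obtain ⟨δ, hδ, hδ2⟩ := h.exists_sq_eq_disc hTm (mem_adjoin_simple_self k V)
    (h.x_mem hZm hν) (h.y_mem hZm hν)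
  have : CharZero k := (RingHom.charZero_iff (algebraMap k Ω).injective).2 inferInstance
  have hinj := (algebraMap k Ω).injective
  obtain ⟨h1, h2⟩ := squarefree_quadratic (a := 1 - 4 * T' * (T' - 1))
    (b := 2 * T' + 4 * T' * (T' - 1)) (c := T' ^ 2)
    (by
      intro h0
      apply h.lead_ne
      have := congrArg (algebraMap k Ω) h0
      simpa only [map_sub, map_mul, map_one, map_ofNat, hT', map_zero] using this)
    (by
      intro h0
      have := congrArg (algebraMap k Ω) h0
      simp only [map_sub, map_add, map_pow, map_mul, map_one, map_ofNat, hT', map_zero] at this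
      have e : 32 * T ^ 3 * (T - 1) = 0 := by linear_combination this
      exact mul_ne_zero (mul_ne_zero (by norm_num) (pow_ne_zero _ h.T_ne)) h.T_sub_one_ne e)
  refine sq_ne_aeval_of_transcendental
    (h.V_transcendental hu ⟨Z', hZ'⟩) h1 h2 hδ ?_
  simp only [map_add, map_sub, map_mul, map_pow, Polynomial.aeval_C, Polynomial.aeval_X, map_ofNat,
    map_one, hT']
  rw [hδ2, disc]
  ring

end

-- `Z` is determined by `t`, `u` and `ν`

section Conjugates

variable {𝕜 Ω : Type*} [Field 𝕜] [CharZero 𝕜] [Field Ω] [CharZero Ω] [Algebra 𝕜 Ω] {t u Z T V x y ν Z' T' V' x' y' : Ω}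

variable (𝕜) in
omit [CharZero Ω] in
theorem Z_mem_algebraicClosure (h : Rel t u Z T V x y ν) :
    Z ∈ (algebraMap (algebraicClosure 𝕜⟮t⟯ Ω) Ω).fieldRange := by
  suffices IsAlgebraic 𝕜⟮t⟯ Z from ⟨⟨Z, mem_algebraicClosure_iff.2 this⟩, rfl⟩
  refine ⟨Polynomial.X * (1 + Polynomial.X ^ 2) -
    Polynomial.C (AdjoinSimple.gen 𝕜 t) * (1 + Polynomial.X) ^ 4, ?_, ?_⟩
  · intro h0
    have := congrArg (Polynomial.eval (-1)) h0
    norm_num at this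
  · simp [h.hZ]

/-- Let `k` be the algebraic closure of `𝕜⟮t⟯` in `Ω`. Both systems give a quadratic equation for
the same `ν` over `k⟮V⟯`; as `ν ∉ k⟮V⟯`, these are proportional, so `Z'^5 = Z^5`. Then `Z' = ωZ`
with `ω^5 = 1`, and the equation of `Z` excludes `ω ≠ 1`. -/
theorem Z_eq_of_rel (h : Rel t u Z T V x y ν) (h' : Rel t u Z' T' V' x' y' ν)
    (ht : Transcendental 𝕜 t) (hu : Transcendental 𝕜⟮t⟯ u) : Z = Z' := by
  have hu' : Transcendental (algebraicClosure 𝕜⟮t⟯ Ω) u := hu.extendScalars _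
  have hZ := h.Z_mem_algebraicClosure 𝕜
  have hZ' := h'.Z_mem_algebraicClosure 𝕜
  have hν := h.ν_notMem hu' hZ
  set k := algebraicClosure 𝕜⟮t⟯ Ω
  let E : Subfield Ω := k⟮V⟯.toSubfield
  have hk : ∀ {z : Ω}, z ∈ (algebraMap k Ω).fieldRange → z ∈ E := by
    rintro _ ⟨z, rfl⟩
    exact IntermediateField.algebraMap_mem k⟮V⟯ z
  have hV : V ∈ E := mem_adjoin_simple_self k V
  have hT : T ∈ E := h.T_mem (hk hZ)
  have ht' : t ∈ E := h.t_mem hT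
  have hum : u ∈ E := h.u_mem hT hV
  -- `V` and `V'` are roots of the same quadratic, whose roots have sum `1/(2tu)`.
  have hV' : V' ∈ E := by
    have e : (V' - V) * (1 - 2 * t * u * (V' + V)) = 0 := by
      linear_combination h'.hV - h.hV
    rcases mul_eq_zero.1 e with e | e
    · rwa [sub_eq_zero.1 e]
    · have hne : 2 * t * u ≠ 0 := mul_ne_zero (mul_ne_zero two_ne_zero h.t_ne) h.u_ne
      have : V' = 1 / (2 * t * u) - V := by
        rw [eq_sub_iff_add_eq, eq_div_iff hne]
        linear_combination -e
      rw [this]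
      exact sub_mem (div_mem (one_mem _) (mul_mem (mul_mem (ofNat_mem _ 2) ht') hum)) hV
  obtain ⟨w, hw, e⟩ := h.exists_quadratic (hk hZ) hV
  obtain ⟨w', hw', e'⟩ := h'.exists_quadratic (hk hZ') hV'
  have h5 : Z' ^ 5 - Z ^ 5 = 0 := by
    by_contra hne
    have e2 : ν * (w * Z' ^ 5 - w' * Z ^ 5) = Z' ^ 5 - Z ^ 5 := by
      linear_combination Z ^ 5 * e' - Z' ^ 5 * e
    apply hν
    rw [eq_div_of_mul_eq (fun h0 => hne (by rw [← e2, h0, mul_zero])) e2]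
    exact div_mem (sub_mem (pow_mem (hk hZ') 5) (pow_mem (hk hZ) 5) : _ ∈ E)
      (sub_mem (mul_mem hw (pow_mem (hk hZ') 5)) (mul_mem hw' (pow_mem (hk hZ) 5)) : _ ∈ E)
  have hZ0 := h.Z_ne
  obtain ⟨ω, rfl⟩ : ∃ ω, Z' = ω * Z := ⟨Z' / Z, (div_mul_cancel₀ _ hZ0).symm⟩
  have hω : ω ^ 5 = 1 := by
    refine mul_right_cancel₀ (pow_ne_zero 5 hZ0) ?_
    linear_combination h5
  have hωm : ω ∈ algebraicClosure 𝕜 Ω := by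
    rw [mem_algebraicClosure_iff]
    refine ⟨Polynomial.X ^ 5 - 1, ?_, by simp [hω]⟩
    exact Polynomial.X_pow_sub_C_ne_zero (by norm_num) (1 : 𝕜)
  have hZt : Transcendental (algebraicClosure 𝕜 Ω) Z := by
    intro hZa
    have hZa : Z ∈ (algebraicClosure 𝕜 Ω) := mem_algebraicClosure_iff.2 (hZa.restrictScalars 𝕜)
    exact ht (mem_algebraicClosure_iff.1
      (h.t_mem (E := (algebraicClosure 𝕜 Ω).toSubfield) (h.T_mem hZa)))
  let ω' : algebraicClosure 𝕜 Ω := ⟨ω, hωm⟩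
  have hω' : algebraMap (algebraicClosure 𝕜 Ω) Ω ω' = ω := rfl
  -- Eliminating `t` between the equations of `Z` and `ωZ` gives a relation for `Z` over the
  -- constants, hence a polynomial identity because `Z` is transcendental. Its value at `0` is `ω -
  -- 1`.
  have hf : Polynomial.C ω' * (1 + Polynomial.C (ω' ^ 2) * Polynomial.X ^ 2) *
      (1 + Polynomial.X) ^ 4 -
      (1 + Polynomial.X ^ 2) * (1 + Polynomial.C ω' * Polynomial.X) ^ 4 = 0 := by
    refine transcendental_iff.1 hZt _ ?_
    simp only [map_add, map_sub, map_mul, map_pow, Polynomial.aeval_C, Polynomial.aeval_X, map_one,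
      hω']
    refine mul_left_cancel₀ hZ0 ?_
    linear_combination (1 + Z) ^ 4 * h'.hZ - (1 + ω * Z) ^ 4 * h.hZ
  have h1 := congrArg (Polynomial.eval 0) hf
  simp [sub_eq_zero] at h1
  have : ω = 1 := by rw [← hω', h1, map_one]
  rw [this, one_mul]

end Conjugates

end Rel

-- Degrees of quadratic steps and towers

section Degrees

variable {𝕜 L : Type*} [Field 𝕜] [Field L] [Algebra 𝕜 L] {F G : IntermediateField 𝕜 L}

theorem extendScalars_eq_adjoin_simple (hFG : F ≤ G) {y : L} (hy : y ∈ G)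
    (hG : G ≤ F ⊔ adjoin 𝕜 {y}) : extendScalars hFG = F⟮y⟯ := by
  apply le_antisymm
  · have h1 : G ≤ F⟮y⟯.restrictScalars 𝕜 := by
      refine hG.trans (sup_le ?_ ?_)
      · intro z hz
        exact IntermediateField.algebraMap_mem F⟮y⟯ (⟨z, hz⟩ : F)
      · rw [adjoin_simple_le_iff]
        exact mem_adjoin_simple_self F y
    intro z hz
    exact h1 hz
  · rw [adjoin_simple_le_iff]
    exact hy

theorem relfinrank_eq_natDegree (hFG : F ≤ G) {y : L} (hy : y ∈ G) (hG : G ≤ F ⊔ adjoin 𝕜 {y})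
    (hi : IsIntegral F y) : relfinrank F G = (minpoly F y).natDegree := by
  rw [relfinrank_eq_finrank_of_le hFG, extendScalars_eq_adjoin_simple hFG hy hG,
    adjoin.finrank hi]

theorem quadratic_monic_natDegree (a b : F) :
    (Polynomial.X ^ 2 - (Polynomial.C a * Polynomial.X + Polynomial.C b)).Monic ∧
      (Polynomial.X ^ 2 - (Polynomial.C a * Polynomial.X + Polynomial.C b)).natDegree = 2 := by
  have h : (Polynomial.C a * Polynomial.X + Polynomial.C b).degree < 2 :=
    Polynomial.degree_linear_lt
  refine ⟨Polynomial.monic_X_pow_sub h, Polynomial.natDegree_eq_of_degree_eq_some ?_⟩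
  rw [Polynomial.degree_sub_eq_left_of_degree_lt (by rwa [Polynomial.degree_X_pow]),
    Polynomial.degree_X_pow, Nat.cast_ofNat]

theorem isIntegral_of_quadratic {y a b : L} (ha : a ∈ F) (hb : b ∈ F) (h : y ^ 2 = a * y + b) :
    IsIntegral F y ∧ (minpoly F y).natDegree ≤ 2 := by
  obtain ⟨h1, h2⟩ := quadratic_monic_natDegree (⟨a, ha⟩ : F) ⟨b, hb⟩
  have h3 : Polynomial.aeval y (Polynomial.X ^ 2 - (Polynomial.C (⟨a, ha⟩ : F) * Polynomial.X +
      Polynomial.C ⟨b, hb⟩)) = 0 := by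
    simp only [map_sub, map_pow, map_add, map_mul, Polynomial.aeval_X, Polynomial.aeval_C, h]
    exact sub_self _
  exact ⟨⟨_, h1, h3⟩, h2 ▸ Polynomial.natDegree_le_of_dvd (minpoly.dvd F y h3) h1.ne_zero⟩

theorem relfinrank_quadratic_le (hFG : F ≤ G) {y a b : L} (hy : y ∈ G)
    (hG : G ≤ F ⊔ adjoin 𝕜 {y}) (ha : a ∈ F) (hb : b ∈ F) (h : y ^ 2 = a * y + b) :
    0 < relfinrank F G ∧ relfinrank F G ≤ 2 := by
  obtain ⟨hi, hd⟩ := isIntegral_of_quadratic ha hb h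
  rw [relfinrank_eq_natDegree hFG hy hG hi]
  exact ⟨minpoly.natDegree_pos hi, hd⟩

theorem relfinrank_quadratic_eq (hFG : F ≤ G) {y a b : L} (hy : y ∈ G)
    (hG : G ≤ F ⊔ adjoin 𝕜 {y}) (ha : a ∈ F) (hb : b ∈ F) (h : y ^ 2 = a * y + b) (hyF : y ∉ F) :
    relfinrank F G = 2 := by
  obtain ⟨hi, hd⟩ := isIntegral_of_quadratic ha hb h
  rw [relfinrank_eq_natDegree hFG hy hG hi]
  refine le_antisymm hd ((minpoly.two_le_natDegree_iff hi).2 ?_)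
  rintro ⟨z, rfl⟩
  exact hyF z.2

theorem isAlgebraic_of_relfinrank_pos (hFG : F ≤ G) (h : 0 < relfinrank F G) {x : L}
    (hx : x ∈ G) : IsAlgebraic F x ∧ (minpoly F x).natDegree ≤ relfinrank F G := by
  rw [relfinrank_eq_finrank_of_le hFG] at h ⊢
  have : FiniteDimensional F (extendScalars hFG) := Module.finite_of_finrank_pos h
  let x' : extendScalars hFG := ⟨x, hx⟩
  have e : minpoly F x = minpoly F x' :=
    (minpoly.algebraMap_eq (algebraMap (extendScalars hFG) L).injective x')
  have : Module.Free F (extendScalars hFG) := Module.Free.of_divisionRing _ _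
  have hd : (minpoly F x').natDegree ≤ Module.finrank F (extendScalars hFG) :=
    minpoly.natDegree_le x'
  refine ⟨?_, e ▸ hd⟩
  exact (IsAlgebraic.algebraMap (A := L) (Algebra.IsAlgebraic.isAlgebraic (R := F) x') :)

end Degrees

theorem degreeLE_of_relfinrank {F G : IntermediateField ℚ K} (hFG : F ≤ G) {d : ℕ}
    (h : 0 < relfinrank F G) (hd : relfinrank F G ≤ d) {x : ℚ[X]⟦X⟧} (hx : toK x ∈ G) :
    DegreeLE F x d := by
  obtain ⟨h1, h2⟩ := isAlgebraic_of_relfinrank_pos hFG h hx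
  exact ⟨h1, h2.trans hd⟩

theorem degreeEq_of_relfinrank {F G : IntermediateField ℚ K} (hFG : F ≤ G) {d : ℕ} (hd : 0 < d)
    (h : relfinrank F G = d) {x : ℚ[X]⟦X⟧} (hx : toK x ∈ G) (hG : G ≤ F ⊔ adjoin ℚ {toK x}) :
    DegreeEq F x d := by
  obtain ⟨h1, -⟩ := isAlgebraic_of_relfinrank_pos hFG (h ▸ hd) hx
  exact ⟨h1, by rw [← h, relfinrank_eq_natDegree hFG hx hG h1.isIntegral]⟩

-- The quadratic tower from `ℚ(t,u)` to `ℚ(Z,V,ν)`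

namespace Rel

variable {Ω : Type*} [Field Ω] [CharZero Ω] [Algebra ℚ Ω] {t u Z T V x y ν : Ω}

theorem adjoin_le_of_subset {S S' : Set Ω} (h : S ⊆ adjoin ℚ S') : adjoin ℚ S ≤ adjoin ℚ S' :=
  adjoin_le_iff.2 h

theorem pair_subset {E : IntermediateField ℚ Ω} {a b : Ω} (ha : a ∈ E) (hb : b ∈ E) :
    ({a, b} : Set Ω) ⊆ E := Set.insert_subset ha (Set.singleton_subset_iff.2 hb)

theorem V_quadratic (h : Rel t u Z T V x y ν) :
    V ^ 2 = 1 / (2 * t * u) * V + -(1 / (2 * t * u)) := by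
  have ht := h.t_ne
  have hu := h.u_ne
  field_simp
  linear_combination -h.hV

theorem T_quadratic (h : Rel t u Z T V x y ν) : T ^ 2 = 1 / (2 * t) * T + -(1 / (2 * t)) := by
  have ht := h.t_ne
  field_simp
  linear_combination -h.hTt

theorem Z_quadratic (h : Rel t u Z T V x y ν) : Z ^ 2 = 2 / (T - 1) * Z + -1 := by
  have ht := h.T_sub_one_ne
  field_simp
  linear_combination h.hT

theorem left_mem (a b : Ω) : a ∈ adjoin ℚ ({a, b} : Set Ω) := subset_adjoin _ _ (by simp)

theorem right_mem (a b : Ω) : b ∈ adjoin ℚ ({a, b} : Set Ω) := subset_adjoin _ _ (by simp)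

theorem T_notMem (h : Rel t u Z T V x y ν) (ht : Transcendental ℚ⟮u⟯ t) :
    T ∉ adjoin ℚ ({t, u} : Set Ω) := by
  intro hT
  obtain ⟨h1, h2⟩ := squarefree_linear (k := ℚ⟮u⟯) (a := -8) (b := 1) (by norm_num)
  have hT' : T ∈ ℚ⟮u⟯⟮t⟯.toSubfield := by
    refine mem_subfield_of_mem_adjoin (Set.insert_subset (mem_adjoin_simple_self _ t)
      (Set.singleton_subset_iff.2 ?_)) hT
    exact IntermediateField.algebraMap_mem ℚ⟮u⟯⟮t⟯ (AdjoinSimple.gen ℚ u)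
  -- Completing the square in `hTt`: `(4tT - 1)^2 = 1 - 8t`.
  refine sq_ne_aeval_of_transcendental ht h1 h2 (y := 4 * t * T - 1)
    (sub_mem (mul_mem (mul_mem (ofNat_mem _ 4) (mem_adjoin_simple_self _ t)) hT') (one_mem _)) ?_
  simp only [map_add, map_mul, Polynomial.aeval_X, map_neg, map_ofNat, map_one]
  linear_combination (-8 * t) * h.hTt

theorem Z_notMem (h : Rel t u Z T V x y ν) (ht : Transcendental ℚ⟮u⟯ t) :
    Z ∉ adjoin ℚ ({T, u} : Set Ω) := by
  intro hZ
  have hT : Transcendental ℚ⟮u⟯ T := by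
    intro hT
    exact ht (mem_algebraicClosure_iff.1 (h.t_mem (E := (algebraicClosure ℚ⟮u⟯ Ω).toSubfield)
      (mem_algebraicClosure_iff.2 hT)))
  obtain ⟨h1, h2⟩ := squarefree_quadratic (k := ℚ⟮u⟯) (a := -1) (b := 2) (c := 0) (by norm_num)
    (by norm_num)
  have hZ' : Z ∈ ℚ⟮u⟯⟮T⟯.toSubfield := by
    refine mem_subfield_of_mem_adjoin (Set.insert_subset (mem_adjoin_simple_self _ T)
      (Set.singleton_subset_iff.2 ?_)) hZ
    exact IntermediateField.algebraMap_mem ℚ⟮u⟯⟮T⟯ (AdjoinSimple.gen ℚ u)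
  -- Completing the square in `hT`: `((T - 1)Z - 1)^2 = 2T - T^2`.
  refine sq_ne_aeval_of_transcendental hT h1 h2 (y := (T - 1) * Z - 1)
    (sub_mem (mul_mem (sub_mem (mem_adjoin_simple_self _ T) (one_mem _)) hZ') (one_mem _)) ?_
  simp only [map_add, map_mul, Polynomial.aeval_X, map_neg, map_ofNat, map_one,
    map_pow, map_zero]
  linear_combination (T - 1) * h.hT

theorem adjoin_t_T_le (h : Rel t u Z T V x y ν) :
    adjoin ℚ ({t, u} : Set Ω) ≤ adjoin ℚ {T, u} ∧
    adjoin ℚ ({T, u} : Set Ω) ≤ adjoin ℚ {t, u} ⊔ adjoin ℚ {T} := by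
  constructor
  · exact adjoin_le_of_subset (pair_subset (h.t_mem (E := (adjoin ℚ ({T, u} : Set Ω)).toSubfield)
      (left_mem T u)) (right_mem T u))
  · rw [adjoin_le_iff]
    exact pair_subset (le_sup_right (a := adjoin ℚ {t, u}) (mem_adjoin_simple_self ℚ T))
      (le_sup_left (b := adjoin ℚ {T}) (right_mem t u))

theorem one_div_mem (t u : Ω) : 1 / (2 * t) ∈ adjoin ℚ ({t, u} : Set Ω) :=
  div_mem (one_mem _) (mul_mem (ofNat_mem _ 2) (left_mem t u))

theorem relfinrank_t_T (h : Rel t u Z T V x y ν) (ht : Transcendental ℚ⟮u⟯ t) :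
    relfinrank (adjoin ℚ ({t, u} : Set Ω)) (adjoin ℚ {T, u}) = 2 :=
  relfinrank_quadratic_eq h.adjoin_t_T_le.1 (left_mem T u) h.adjoin_t_T_le.2
    (one_div_mem t u) (neg_mem (one_div_mem t u)) h.T_quadratic (h.T_notMem ht)

theorem T_le_Z (h : Rel t u Z T V x y ν) :
    adjoin ℚ ({T, u} : Set Ω) ≤ adjoin ℚ {u, Z} :=
  adjoin_le_of_subset (pair_subset (h.T_mem (E := (adjoin ℚ ({u, Z} : Set Ω)).toSubfield)
    (right_mem u Z)) (left_mem u Z))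

theorem relfinrank_T_Z (h : Rel t u Z T V x y ν) (ht : Transcendental ℚ⟮u⟯ t) :
    relfinrank (adjoin ℚ ({T, u} : Set Ω)) (adjoin ℚ {u, Z}) = 2 := by
  refine relfinrank_quadratic_eq h.T_le_Z (right_mem u Z) ?_
    (div_mem (ofNat_mem _ 2) (sub_mem (left_mem T u) (one_mem _))) (neg_mem (one_mem _))
    h.Z_quadratic (h.Z_notMem ht)
  rw [adjoin_le_iff]
  exact pair_subset (le_sup_left (b := adjoin ℚ {Z}) (right_mem T u))
    (le_sup_right (a := adjoin ℚ {T, u}) (mem_adjoin_simple_self ℚ Z))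

theorem Z_le_V (h : Rel t u Z T V x y ν) :
    adjoin ℚ ({u, Z} : Set Ω) ≤ adjoin ℚ {Z, V} :=
  adjoin_le_of_subset (pair_subset (h.u_mem (E := (adjoin ℚ ({Z, V} : Set Ω)).toSubfield)
    (h.T_mem (left_mem Z V)) (right_mem Z V)) (left_mem Z V))

theorem relfinrank_Z_V (h : Rel t u Z T V x y ν) (hu : Transcendental ℚ⟮t⟯ u) :
    relfinrank (adjoin ℚ ({u, Z} : Set Ω)) (adjoin ℚ {Z, V}) = 2 := by
  have ht : t ∈ (adjoin ℚ ({u, Z} : Set Ω)) :=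
    h.t_mem (E := (adjoin ℚ ({u, Z} : Set Ω)).toSubfield) (h.T_mem (right_mem u Z))
  have hd : 1 / (2 * t * u) ∈ (adjoin ℚ ({u, Z} : Set Ω)) :=
    div_mem (one_mem _) (mul_mem (mul_mem (ofNat_mem _ 2) ht) (left_mem u Z))
  have hZ := h.Z_mem_algebraicClosure ℚ
  refine relfinrank_quadratic_eq h.Z_le_V (right_mem Z V) ?_ hd (neg_mem hd) h.V_quadratic ?_
  · rw [adjoin_le_iff]
    exact pair_subset (le_sup_left (b := adjoin ℚ {V}) (right_mem u Z))
      (le_sup_right (a := adjoin ℚ {u, Z}) (mem_adjoin_simple_self ℚ V))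
  · intro hV
    refine h.V_notMem (hu.extendScalars (algebraicClosure ℚ⟮t⟯ Ω)) hZ ?_
    obtain ⟨z, hz⟩ := hZ
    exact mem_subfield_of_mem_adjoin (E := (algebraicClosure ℚ⟮t⟯ Ω)⟮u⟯.toSubfield)
      (Set.insert_subset (mem_adjoin_simple_self _ u)
        (Set.singleton_subset_iff.2 (hz ▸ IntermediateField.algebraMap_mem _ z))) hV

theorem relfinrank_V_ν (h : Rel t u Z T V x y ν) (hu : Transcendental ℚ⟮t⟯ u) :
    relfinrank (adjoin ℚ ({Z, V} : Set Ω)) (adjoin ℚ {Z, V} ⊔ adjoin ℚ {ν}) = 2 := by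
  have hZ := h.Z_mem_algebraicClosure ℚ
  have hZm : Z ∈ adjoin ℚ ({Z, V} : Set Ω) := left_mem Z V
  obtain ⟨w, hw, e⟩ := h.exists_quadratic (E := (adjoin ℚ ({Z, V} : Set Ω)).toSubfield)
    hZm (right_mem Z V)
  have hZ0 := h.Z_ne
  refine relfinrank_quadratic_eq le_sup_left (y := ν) (a := w / Z ^ 5) (b := -1 / Z ^ 5)
    (le_sup_right (a := adjoin ℚ {Z, V}) (mem_adjoin_simple_self ℚ ν)) le_rfl
    (div_mem hw (pow_mem hZm 5)) (div_mem (neg_mem (one_mem _)) (pow_mem hZm 5)) ?_ ?_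
  · field_simp
    linear_combination e
  · intro hν
    refine h.ν_notMem (hu.extendScalars (algebraicClosure ℚ⟮t⟯ Ω)) hZ ?_
    obtain ⟨z, hz⟩ := hZ
    exact mem_subfield_of_mem_adjoin (E := (algebraicClosure ℚ⟮t⟯ Ω)⟮V⟯.toSubfield)
      (Set.insert_subset (hz ▸ IntermediateField.algebraMap_mem _ z)
        (Set.singleton_subset_iff.2 (mem_adjoin_simple_self _ V))) hν

theorem relfinrank_Z_ν (h : Rel t u Z T V x y ν) (hu : Transcendental ℚ⟮t⟯ u) :
    relfinrank (adjoin ℚ ({u, Z} : Set Ω)) (adjoin ℚ {Z, V} ⊔ adjoin ℚ {ν}) = 4 := by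
  rw [← relfinrank_mul_relfinrank h.Z_le_V le_sup_left, h.relfinrank_Z_V hu, h.relfinrank_V_ν hu]

theorem relfinrank_t_ν (h : Rel t u Z T V x y ν) (hu : Transcendental ℚ⟮t⟯ u)
    (ht : Transcendental ℚ⟮u⟯ t) :
    relfinrank (adjoin ℚ ({t, u} : Set Ω)) (adjoin ℚ {Z, V} ⊔ adjoin ℚ {ν}) = 16 := by
  rw [← relfinrank_mul_relfinrank h.adjoin_t_T_le.1
    ((h.T_le_Z.trans h.Z_le_V).trans le_sup_left), h.relfinrank_t_T ht,
    ← relfinrank_mul_relfinrank h.T_le_Z (h.Z_le_V.trans le_sup_left), h.relfinrank_T_Z ht,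
    h.relfinrank_Z_ν hu]

theorem adjoin_le_Z_sup_ν (h : Rel t u Z T V x y ν) :
    adjoin ℚ {Z, V} ⊔ adjoin ℚ {ν} ≤ adjoin ℚ ({u, Z} : Set Ω) ⊔ adjoin ℚ {ν} := by
  refine sup_le ?_ le_sup_right
  have hu : u ∈ adjoin ℚ ({u, Z} : Set Ω) ⊔ adjoin ℚ {ν} :=
    le_sup_left (b := adjoin ℚ {ν}) (left_mem u Z)
  have hZ : Z ∈ adjoin ℚ ({u, Z} : Set Ω) ⊔ adjoin ℚ {ν} :=
    le_sup_left (b := adjoin ℚ {ν}) (right_mem u Z)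
  have hν : ν ∈ adjoin ℚ ({u, Z} : Set Ω) ⊔ adjoin ℚ {ν} :=
    le_sup_right (a := adjoin ℚ {u, Z}) (mem_adjoin_simple_self ℚ ν)
  rw [adjoin_le_iff]
  exact pair_subset hZ
    (h.V_mem (E := (adjoin ℚ ({u, Z} : Set Ω) ⊔ adjoin ℚ {ν}).toSubfield) hZ hu hν)

theorem transcendental_of_algebraicIndependent (h : AlgebraicIndependent ℚ ![t, u]) :
    Transcendental ℚ⟮t⟯ u ∧ Transcendental ℚ⟮u⟯ t := by
  have h1 := h.transcendental_adjoin (s := {0}) (i := 1) (by simp)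
  have h2 := h.transcendental_adjoin (s := {1}) (i := 0) (by simp)
  have e1 : ![t, u] '' {0} = {t} := by simp
  have e2 : ![t, u] '' {1} = {u} := by simp
  rw [e1] at h1
  rw [e2] at h2
  exact ⟨transcendental_adjoin_iff.2 h1, transcendental_adjoin_iff.2 h2⟩

/-- By separability `Z` has another conjugate over `M = ℚ(t,u,ν)`. All the quantities of `Rel` lie
in `M⟮Z⟯`, so the embedding of `M⟮Z⟯` that sends `Z` to this conjugate transports the whole system
and fixes `t, u, ν`. -/
theorem exists_conjugate (h : Rel t u Z T V x y ν) (hZ : Z ∉ adjoin ℚ ({t, u, ν} : Set Ω)) :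
    ∃ Z' T' V' x' y' : AlgebraicClosure Ω, Z' ≠ algebraMap Ω _ Z ∧
      Rel (algebraMap Ω _ t) (algebraMap Ω _ u) Z' T' V' x' y' (algebraMap Ω _ ν) := by
  set M := adjoin ℚ ({t, u, ν} : Set Ω) with hM
  let A := AlgebraicClosure Ω
  have ht : t ∈ M := subset_adjoin _ _ (by simp)
  have hu : u ∈ M := subset_adjoin _ _ (by simp)
  have hν : ν ∈ M := subset_adjoin _ _ (by simp)
  have hi : IsIntegral M Z := by
    refine IsAlgebraic.isIntegral ⟨Polynomial.X * (1 + Polynomial.X ^ 2) -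
      Polynomial.C (⟨t, ht⟩ : M) * (1 + Polynomial.X) ^ 4, ?_, ?_⟩
    · intro h0
      have := congrArg (Polynomial.eval (-1)) h0
      norm_num at this
    · simp only [map_sub, map_mul, map_add, map_one, map_pow, Polynomial.aeval_X,
        Polynomial.aeval_C, h.hZ]
      exact sub_self _
  have hi' : IsIntegral M (algebraMap Ω A Z) := hi.algebraMap
  have hbot : algebraMap Ω A Z ∉ (⊥ : Subalgebra M A) := by
    rintro ⟨z, hz⟩
    refine hZ ?_
    rw [← (algebraMap Ω A).injective (a₁ := z) (a₂ := Z) hz]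
    exact z.2
  obtain ⟨Z', hne, hconj⟩ := (notMem_iff_exists_ne_and_isConjRoot
    ((minpoly.irreducible hi').separable) (IsAlgClosed.splits _)).1 hbot
  have hroot : Polynomial.aeval Z' (minpoly M Z) = 0 := by
    rw [← minpoly.algebraMap_eq (algebraMap Ω A).injective Z]
    exact hconj.aeval_eq_zero
  let E := M⟮Z⟯
  obtain ⟨σ, hσ⟩ : ∃ σ : E →ₐ[M] A, σ (adjoin.powerBasis hi).gen = Z' :=
    ⟨_, (adjoin.powerBasis hi).lift_gen Z' (by rwa [adjoin.powerBasis_gen, minpoly_gen])⟩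
  rw [adjoin.powerBasis_gen] at hσ
  have hZE : Z ∈ E.toSubfield := mem_adjoin_simple_self M Z
  have hm : ∀ z (hz : z ∈ M), z ∈ E.toSubfield := fun z hz =>
    IntermediateField.algebraMap_mem E (⟨z, hz⟩ : M)
  have hσM : ∀ z (hz : z ∈ M), σ ⟨z, hm z hz⟩ = algebraMap Ω A z := fun z hz =>
    σ.commutes ⟨z, hz⟩
  have hT := h.T_mem hZE
  have hV := h.V_mem hZE (hm u hu) (hm ν hν)
  have hx := h.x_mem hZE (hm ν hν)
  have hy := h.y_mem hZE (hm ν hν)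
  have h1 : Rel (⟨t, hm t ht⟩ : E) ⟨u, hm u hu⟩ ⟨Z, hZE⟩ ⟨T, hT⟩ ⟨V, hV⟩ ⟨x, hx⟩ ⟨y, hy⟩
      ⟨ν, hm ν hν⟩ := (Rel.map_iff (algebraMap E Ω)).1 h
  have h2 := (Rel.map_iff (σ : E →+* A)).2 h1
  have h3 : Rel (algebraMap Ω A t) (algebraMap Ω A u) Z' (σ ⟨T, hT⟩) (σ ⟨V, hV⟩) (σ ⟨x, hx⟩)
      (σ ⟨y, hy⟩) (algebraMap Ω A ν) := by
    rw [← hσ, ← hσM t ht, ← hσM u hu, ← hσM ν hν]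
    exact h2
  exact ⟨Z', _, _, _, _, hne.symm, h3⟩

theorem Z_mem_adjoin (h : Rel t u Z T V x y ν) (hind : AlgebraicIndependent ℚ ![t, u]) :
    Z ∈ adjoin ℚ ({t, u, ν} : Set Ω) := by
  by_contra hZ
  obtain ⟨Z', T', V', x', y', hne, h'⟩ := h.exists_conjugate hZ
  have hind' : AlgebraicIndependent ℚ ![algebraMap Ω (AlgebraicClosure Ω) t,
      algebraMap Ω (AlgebraicClosure Ω) u] := by
    have := hind.map' (f := IsScalarTower.toAlgHom ℚ Ω (AlgebraicClosure Ω))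
      (algebraMap Ω (AlgebraicClosure Ω)).injective
    convert this using 1
    ext i
    fin_cases i <;> rfl
  exact hne (((Rel.map_iff (algebraMap Ω (AlgebraicClosure Ω))).2 h).Z_eq_of_rel h'
    (hind'.transcendental 0) (transcendental_of_algebraicIndependent hind').1).symm

theorem adjoin_le_t_sup_ν (h : Rel t u Z T V x y ν) (hind : AlgebraicIndependent ℚ ![t, u]) :
    adjoin ℚ {Z, V} ⊔ adjoin ℚ {ν} ≤ adjoin ℚ ({t, u} : Set Ω) ⊔ adjoin ℚ {ν} := by
  refine h.adjoin_le_Z_sup_ν.trans (sup_le ?_ le_sup_right)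
  have e : adjoin ℚ ({t, u, ν} : Set Ω) ≤ adjoin ℚ {t, u} ⊔ adjoin ℚ {ν} := by
    rw [adjoin_le_iff]
    refine Set.insert_subset (le_sup_left (b := adjoin ℚ {ν}) (left_mem t u))
      (Set.insert_subset (le_sup_left (b := adjoin ℚ {ν}) (right_mem t u))
      (Set.singleton_subset_iff.2 (le_sup_right (a := adjoin ℚ {t, u})
        (mem_adjoin_simple_self ℚ ν))))
  rw [adjoin_le_iff]
  exact pair_subset (le_sup_left (b := adjoin ℚ {ν}) (right_mem t u)) (e (h.Z_mem_adjoin hind))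

end Rel

-- The field `K` and the independence of `t` and `u`

theorem toK_injective : Function.Injective toK := IsFractionRing.injective ℚ[X]⟦X⟧ K

instance (priority := 2000) algebraRatK : Algebra ℚ K := OreLocalization.instAlgebra

instance charZeroK : CharZero K := algebraRat.charZero K

theorem toK_ne_zero {f : ℚ[X]⟦X⟧} (h : PowerSeries.constantCoeff f ≠ 0) : toK f ≠ 0 := by
  rw [Ne, map_eq_zero_iff _ toK_injective]
  rintro rfl
  exact h (map_zero _)

theorem transcendental_powerSeries_X (B : Type*) [CommRing B] :
    Transcendental B (PowerSeries.X : B⟦X⟧) := by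
  have e : ∀ p : B[X], Polynomial.aeval (PowerSeries.X : B⟦X⟧) p = (p : B⟦X⟧) := by
    intro p
    have : Polynomial.aeval (PowerSeries.X : B⟦X⟧) =
        Polynomial.coeToPowerSeries.algHom (R := B) B := by
      ext
      simp [Polynomial.coeToPowerSeries.algHom_apply]
    rw [this]
    simp [Polynomial.coeToPowerSeries.algHom_apply]
  rw [transcendental_iff]
  intro p hp
  rw [e] at hp
  exact_mod_cast hp

/-- Independence in a tower: `b` is transcendental over `R`, and `X` over all of `B`. -/
theorem algebraicIndependent_X_C {R B : Type*} [CommRing R] [CommRing B] [Algebra R B] {b : B}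
    (hb : Transcendental R b) :
    AlgebraicIndependent R ![(PowerSeries.X : B⟦X⟧), PowerSeries.C b] := by
  have h1 : AlgebraicIndependent R (fun _ : Unit => b) :=
    (algebraicIndependent_unique_type_iff).2 hb
  have h2 : AlgebraicIndependent B (fun _ : Unit => (PowerSeries.X : B⟦X⟧)) :=
    (algebraicIndependent_unique_type_iff).2 (transcendental_powerSeries_X B)
  have h3 := (AlgebraicIndependent.sumElim_comp h1 h2).comp ![Sum.inl (), Sum.inr ()] (by
    intro i j
    fin_cases i <;> fin_cases j <;> simp)
  convert h3 using 1
  ext1 i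
  fin_cases i <;> simp

theorem algebraicIndependent_t_u : AlgebraicIndependent ℚ ![toK t, toK u] := by
  have h := (algebraicIndependent_X_C (Polynomial.transcendental_X ℚ)).map'
    (f := IsScalarTower.toAlgHom ℚ ℚ[X]⟦X⟧ K) toK_injective
  convert h using 1
  ext i
  fin_cases i <;> rfl

-- The product form

theorem product_form_recursion {F : Type*} [Field F] [CharZero F] {t Z T a : F}
    (hT : T * (1 + Z ^ 2) = (1 + Z) ^ 2) (hTt : T = 1 + 2 * t * T ^ 2) (hZ : 1 + Z ^ 2 ≠ 0)
    (h1 : 1 + a * Z ≠ 0) (h2 : 1 + a * Z ^ 2 ≠ 0) (h3 : 1 + a * Z ^ 3 ≠ 0)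
    (h4 : 1 + a * Z ^ 4 ≠ 0) (h5 : 1 + a * Z ^ 5 ≠ 0) :
    T * ((1 + a * Z) * (1 + a * Z ^ 5)) / ((1 + a * Z ^ 2) * (1 + a * Z ^ 4)) =
      1 + t * (T * ((1 + a * Z) * (1 + a * Z ^ 5)) / ((1 + a * Z ^ 2) * (1 + a * Z ^ 4))) *
        (T * ((1 + a) * (1 + a * Z ^ 4)) / ((1 + a * Z) * (1 + a * Z ^ 3)) +
          T * ((1 + a * Z ^ 2) * (1 + a * Z ^ 6)) / ((1 + a * Z ^ 3) * (1 + a * Z ^ 5))) := by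
  -- Since `2tT^2 = T - 1`, both `T` and `tT^2` are rational in `Z`, and the recursion becomes a
  -- polynomial identity in `a` and `Z`.
  have hq : t * T ^ 2 * (1 + Z ^ 2) = Z := by
    linear_combination (1 / 2) * hT - (1 / 2) * (1 + Z ^ 2) * hTt
  have key : T * (1 + a * Z) * (1 + a * Z ^ 5) * (1 + a * Z ^ 3) =
      (1 + a * Z ^ 2) * (1 + a * Z ^ 3) * (1 + a * Z ^ 4) +
      t * T ^ 2 * ((1 + a) * (1 + a * Z ^ 5) * (1 + a * Z ^ 4) +
        (1 + a * Z) * (1 + a * Z ^ 6) * (1 + a * Z ^ 2)) := by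
    refine mul_right_cancel₀ hZ ?_
    linear_combination (1 + a * Z) * (1 + a * Z ^ 5) * (1 + a * Z ^ 3) * hT -
      ((1 + a) * (1 + a * Z ^ 5) * (1 + a * Z ^ 4) +
        (1 + a * Z) * (1 + a * Z ^ 6) * (1 + a * Z ^ 2)) * hq
  have e1 : t * (T * ((1 + a * Z) * (1 + a * Z ^ 5)) / ((1 + a * Z ^ 2) * (1 + a * Z ^ 4))) *
      (T * ((1 + a) * (1 + a * Z ^ 4)) / ((1 + a * Z) * (1 + a * Z ^ 3)) +
        T * ((1 + a * Z ^ 2) * (1 + a * Z ^ 6)) / ((1 + a * Z ^ 3) * (1 + a * Z ^ 5))) =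
      t * T ^ 2 * ((1 + a) * (1 + a * Z ^ 5) * (1 + a * Z ^ 4) +
        (1 + a * Z) * (1 + a * Z ^ 6) * (1 + a * Z ^ 2)) /
        ((1 + a * Z ^ 2) * (1 + a * Z ^ 3) * (1 + a * Z ^ 4)) := by
    generalize 1 + a * Z = p1 at *
    generalize 1 + a * Z ^ 2 = p2 at *
    generalize 1 + a * Z ^ 3 = p3 at *
    generalize 1 + a * Z ^ 4 = p4 at *
    generalize 1 + a * Z ^ 5 = p5 at *
    field_simp
  rw [e1]
  field_simp
  linear_combination key

section Nu

variable {A : Type*} [CommRing A] {t T Z a : A⟦X⟧}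

/-- The map whose fixed point is the series `ν`. -/
def nuMap (T Z a f : A⟦X⟧) : A⟦X⟧ :=
  (1 - 2 * PowerSeries.X * T) * a * ((1 + f * Z) * (1 + f * Z ^ 3)) - 1 - f * Z ^ 4 * (1 + f)

theorem nuMap_contraction (hZ : PowerSeries.X ∣ Z) (f g : A⟦X⟧) :
    PowerSeries.X * (f - g) ∣ nuMap T Z a f - nuMap T Z a g := by
  obtain ⟨Y, rfl⟩ := hZ
  refine ⟨(1 - 2 * PowerSeries.X * T) * a * (Y + PowerSeries.X ^ 2 * Y ^ 3 +
    (f + g) * PowerSeries.X ^ 3 * Y ^ 4) - PowerSeries.X ^ 3 * Y ^ 4 * (1 + f + g), ?_⟩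
  rw [nuMap, nuMap]
  ring

/-- The factor `1 - 2XT` in `nuMap` is the inverse of `T`. The fixed-point equation is thus the
product form at `j = 0`, with `a` in the role of `R_0`. -/
theorem nuMap_fixed (hT : T = 1 + 2 * PowerSeries.X * T ^ 2) {f : A⟦X⟧}
    (hf : nuMap T Z a f = f) :
    a * ((1 + f * Z) * (1 + f * Z ^ 3)) = T * ((1 + f) * (1 + f * Z ^ 4)) := by
  rw [nuMap] at hf
  linear_combination T * hf - a * ((1 + f * Z) * (1 + f * Z ^ 3)) * hT

end Nu

theorem R_eq_product {Z : ℚ[X]⟦X⟧} {ν : ℚ[X]⟦X⟧} (hZ0 : PowerSeries.constantCoeff Z = 0)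
    (hT : constU T * (1 + Z ^ 2) = (1 + Z) ^ 2)
    (hν : R 0 * ((1 + ν * Z) * (1 + ν * Z ^ 3)) = constU T * ((1 + ν) * (1 + ν * Z ^ 4))) (j : ℕ) :
    toK (R j) = toK (constU T) * (toK (1 + ν * Z ^ j) * toK (1 + ν * Z ^ (j + 4))) /
      (toK (1 + ν * Z ^ (j + 1)) * toK (1 + ν * Z ^ (j + 3))) := by
  let P : ℕ → ℚ[X]⟦X⟧ := fun n => 1 + ν * Z ^ n
  -- Only `P (n + 1)` is inverted: its constant term is `1`, unlike that of `P 0 = 1 + ν`. So the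
  -- quotients are power series and `recursion_unique` applies.
  let Q : ℕ → ℚ[X]⟦X⟧ := fun n => PowerSeries.invOfUnit (P n) 1
  have hc : ∀ n, PowerSeries.constantCoeff (P (n + 1)) = 1 := by
    intro n
    simp [P, hZ0]
  have hPQ : ∀ n, P (n + 1) * Q (n + 1) = 1 := fun n =>
    PowerSeries.mul_invOfUnit _ _ (by rw [hc, Units.val_one])
  have hPne : ∀ n, toK (P (n + 1)) ≠ 0 := fun n => toK_ne_zero (by rw [hc]; exact one_ne_zero)
  have hQ : ∀ n, toK (Q (n + 1)) = (toK (P (n + 1)))⁻¹ := fun n => by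
    refine eq_inv_of_mul_eq_one_left ?_
    rw [← map_mul, mul_comm, hPQ, map_one]
  obtain ⟨r, hr⟩ : ∃ r : ℕ → ℚ[X]⟦X⟧, ∀ n, toK (r n) = toK (constU T) *
      (toK (P n) * toK (P (n + 4))) / (toK (P (n + 1)) * toK (P (n + 3))) := by
    refine ⟨fun n => constU T * (P n * P (n + 4)) * (Q (n + 1) * Q (n + 3)), fun n => ?_⟩
    simp only [map_mul, hQ]
    rw [div_eq_mul_inv, mul_inv]
  have hrec : ∀ n, r (n + 1) = 1 + PowerSeries.X * r (n + 1) * (r n + r (n + 2)) := by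
    intro n
    apply toK_injective
    rw [map_add, map_mul, map_mul, map_add, map_one, hr, hr, hr]
    have hP : ∀ i, toK (P (n + i)) = 1 + toK (ν * Z ^ n) * toK Z ^ i := by
      intro i
      simp only [P, pow_add, map_add, map_mul, map_one, map_pow, mul_assoc]
    have hne : ∀ i, 1 + toK (ν * Z ^ n) * toK Z ^ (i + 1) ≠ 0 := by
      intro i
      rw [← hP]
      exact hPne _
    have hZne : 1 + toK Z ^ 2 ≠ 0 := by
      have := toK_ne_zero (f := 1 + Z ^ 2) (by simp [hZ0])
      simpa only [map_add, map_one, map_pow] using this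
    have key := product_form_recursion (t := toK t) (T := toK (constU T)) (Z := toK Z)
      (a := toK (ν * Z ^ n))
      (by
        have := congrArg toK hT
        simpa only [map_add, map_mul, map_one, map_pow] using this)
      (by
        have := congrArg toK constU_T_rec
        simpa only [map_add, map_mul, map_one, map_pow, map_ofNat] using this)
      hZne (by simpa using hne 0) (hne 1) (hne 2) (hne 3) (hne 4)
    have hP0 : toK (P n) = 1 + toK (ν * Z ^ n) := by simpa using hP 0
    simp only [add_assoc, Nat.reduceAdd] at *
    rw [hP0, hP 1, hP 2, hP 3, hP 4, hP 5, hP 6, pow_one]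
    exact key
  have h0 : R 0 = r 0 := by
    apply toK_injective
    have := congrArg toK hν
    rw [map_mul, map_mul, map_mul, map_mul] at this
    rw [hr, eq_div_iff (mul_ne_zero (hPne 0) (hPne 2))]
    simpa only [P, pow_zero, mul_one, zero_add, pow_one] using this
  have h0' : R ((0 : ℕ) : ℤ) = r 0 := by rw [Nat.cast_zero, h0]
  have hR : ∀ n : ℕ, R ((n + 1 : ℕ) : ℤ) = 1 + PowerSeries.X * R ((n + 1 : ℕ) : ℤ) *
      (R (n : ℤ) + R ((n + 2 : ℕ) : ℤ)) := by
    intro n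
    have := R_rec_of_pos (j := n + 1) (by omega)
    rw [add_sub_cancel_right, add_assoc] at this
    push_cast
    exact this
  have e : R (j : ℤ) = r j := recursion_unique (r := fun n : ℕ => R n) hR hrec h0' j
  rw [e, hr]

-- Expansions up to `t^3`

section Coefficients

variable {A : Type*} [CommRing A] (f g : A⟦X⟧)

theorem coeff_mul_zero : PowerSeries.coeff 0 (f * g) =
    PowerSeries.coeff 0 f * PowerSeries.coeff 0 g := by
  simp [PowerSeries.coeff_mul]

theorem coeff_mul_one : PowerSeries.coeff 1 (f * g) =
    PowerSeries.coeff 0 f * PowerSeries.coeff 1 g + PowerSeries.coeff 1 f * PowerSeries.coeff 0 g := by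
  rw [PowerSeries.coeff_mul, Finset.Nat.sum_antidiagonal_eq_sum_range_succ_mk]
  simp [Finset.sum_range_succ]

theorem coeff_mul_two : PowerSeries.coeff 2 (f * g) =
    PowerSeries.coeff 0 f * PowerSeries.coeff 2 g + PowerSeries.coeff 1 f * PowerSeries.coeff 1 g +
      PowerSeries.coeff 2 f * PowerSeries.coeff 0 g := by
  rw [PowerSeries.coeff_mul, Finset.Nat.sum_antidiagonal_eq_sum_range_succ_mk]
  simp [Finset.sum_range_succ]

theorem coeff_mul_three : PowerSeries.coeff 3 (f * g) =
    PowerSeries.coeff 0 f * PowerSeries.coeff 3 g + PowerSeries.coeff 1 f * PowerSeries.coeff 2 g +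
      PowerSeries.coeff 2 f * PowerSeries.coeff 1 g +
        PowerSeries.coeff 3 f * PowerSeries.coeff 0 g := by
  rw [PowerSeries.coeff_mul, Finset.Nat.sum_antidiagonal_eq_sum_range_succ_mk]
  simp [Finset.sum_range_succ]

end Coefficients

theorem coeff_zero_R (j : ℤ) : PowerSeries.coeff 0 (R j) = nodeWeight 0 j := by
  rw [R_rec]; simp [t]

theorem coeff_succ_R (n : ℕ) (j : ℤ) : PowerSeries.coeff (n + 1) (R j) =
    PowerSeries.coeff n (R j * (R (j - 1) + R (j + 1))) := by
  conv_lhs => rw [R_rec, t, mul_assoc, map_add, PowerSeries.coeff_succ_X_mul, PowerSeries.coeff_C,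
    if_neg n.succ_ne_zero, zero_add]

theorem coeff_one_R (j : ℤ) : PowerSeries.coeff 1 (R j) =
    nodeWeight 0 j * (nodeWeight 0 (j - 1) + nodeWeight 0 (j + 1)) := by
  rw [coeff_succ_R, coeff_mul_zero, map_add]
  simp only [coeff_zero_R]

theorem coeff_two_R (j : ℤ) : PowerSeries.coeff 2 (R j) =
    nodeWeight 0 j * (PowerSeries.coeff 1 (R (j - 1)) + PowerSeries.coeff 1 (R (j + 1))) +
      PowerSeries.coeff 1 (R j) * (nodeWeight 0 (j - 1) + nodeWeight 0 (j + 1)) := by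
  rw [coeff_succ_R, coeff_mul_one, map_add, map_add]
  simp only [coeff_zero_R]

theorem coeff_three_R (j : ℤ) : PowerSeries.coeff 3 (R j) =
    nodeWeight 0 j * (PowerSeries.coeff 2 (R (j - 1)) + PowerSeries.coeff 2 (R (j + 1))) +
      PowerSeries.coeff 1 (R j) *
        (PowerSeries.coeff 1 (R (j - 1)) + PowerSeries.coeff 1 (R (j + 1))) +
      PowerSeries.coeff 2 (R j) * (nodeWeight 0 (j - 1) + nodeWeight 0 (j + 1)) := by
  rw [coeff_succ_R, coeff_mul_two, map_add, map_add, map_add]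
  simp only [coeff_zero_R]

theorem coeff_R_zero :
    PowerSeries.coeff 0 (R 0) = Polynomial.X ∧
    PowerSeries.coeff 1 (R 0) = Polynomial.X * (1 + Polynomial.X) ∧
    PowerSeries.coeff 2 (R 0) =
      Polynomial.X * (2 + 3 * Polynomial.X + 3 * Polynomial.X ^ 2) ∧
    PowerSeries.coeff 3 (R 0) = Polynomial.X *
      (6 + 10 * Polynomial.X + 12 * Polynomial.X ^ 2 + 12 * Polynomial.X ^ 3) := by
  simp only [coeff_three_R, coeff_two_R, coeff_one_R, coeff_zero_R]
  norm_num [nodeWeight]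
  refine ⟨?_, ?_, ?_⟩ <;> ring

theorem coeff_T :
    PowerSeries.coeff 0 (constU T) = 1 ∧ PowerSeries.coeff 1 (constU T) = 2 ∧
    PowerSeries.coeff 2 (constU T) = 8 ∧ PowerSeries.coeff 3 (constU T) = 40 := by
  have hs : ∀ n, PowerSeries.coeff (n + 1) (constU T) =
      PowerSeries.coeff n (constU T * (constU T + constU T)) := by
    intro n
    have e : constU T = 1 + PowerSeries.X * (constU T * (constU T + constU T)) := by
      conv_lhs => rw [constU_T_rec]
      rw [t]; ring
    conv_lhs => rw [e, map_add, PowerSeries.coeff_succ_X_mul, PowerSeries.coeff_one,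
      if_neg n.succ_ne_zero, zero_add]
  have h0 : PowerSeries.coeff 0 (constU T) = 1 := by
    rw [constU_T_rec]; simp [t]
  have h1 : PowerSeries.coeff 1 (constU T) = 2 := by
    rw [hs, coeff_mul_zero, map_add, h0]; norm_num
  have h2 : PowerSeries.coeff 2 (constU T) = 8 := by
    rw [hs, coeff_mul_one, map_add, map_add, h0, h1]; norm_num
  refine ⟨h0, h1, h2, ?_⟩
  rw [hs, coeff_mul_two, map_add, map_add, map_add, h0, h1, h2]; norm_num

theorem coeff_pow_three_of_X_dvd {A : Type*} [CommRing A] {Z : A⟦X⟧} (h : PowerSeries.X ∣ Z) :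
    PowerSeries.coeff 0 (Z ^ 3) = 0 ∧ PowerSeries.coeff 1 (Z ^ 3) = 0 ∧
      PowerSeries.coeff 2 (Z ^ 3) = 0 ∧
      PowerSeries.coeff 3 (Z ^ 3) = PowerSeries.coeff 1 Z ^ 3 := by
  obtain ⟨Y, rfl⟩ := h
  rw [mul_pow]
  have h1 : PowerSeries.coeff 1 (PowerSeries.X * Y) = PowerSeries.coeff 0 Y :=
    PowerSeries.coeff_succ_X_mul 0 Y
  refine ⟨by simp [PowerSeries.coeff_X_pow_mul'], by simp [PowerSeries.coeff_X_pow_mul'],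
    by simp [PowerSeries.coeff_X_pow_mul'], ?_⟩
  rw [h1, PowerSeries.coeff_X_pow_mul']
  simp

theorem coeff_Z {A : Type*} [CommRing A] {Z : A⟦X⟧} (h0 : PowerSeries.X ∣ Z)
    (h : Z * (1 + Z ^ 2) = PowerSeries.X * (1 + Z) ^ 4) :
    PowerSeries.coeff 0 Z = 0 ∧ PowerSeries.coeff 1 Z = 1 ∧ PowerSeries.coeff 2 Z = 4 ∧
      PowerSeries.coeff 3 Z = 21 := by
  have e : Z + Z ^ 3 = PowerSeries.X * ((1 + Z) * (1 + Z) * ((1 + Z) * (1 + Z))) := by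
    linear_combination h
  have hs : ∀ n, PowerSeries.coeff (n + 1) Z + PowerSeries.coeff (n + 1) (Z ^ 3) =
      PowerSeries.coeff n ((1 + Z) * (1 + Z) * ((1 + Z) * (1 + Z))) := by
    intro n
    rw [← map_add, e, PowerSeries.coeff_succ_X_mul]
  obtain ⟨-, c1, c2, c3⟩ := coeff_pow_three_of_X_dvd h0
  have z0 : PowerSeries.coeff 0 Z = 0 := by
    rw [PowerSeries.coeff_zero_eq_constantCoeff_apply, PowerSeries.X_dvd_iff.1 h0]
  have o0 : PowerSeries.coeff 0 (1 : A⟦X⟧) = 1 := by simp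
  have o1 : PowerSeries.coeff 1 (1 : A⟦X⟧) = 0 := by simp [PowerSeries.coeff_one]
  have o2 : PowerSeries.coeff 2 (1 : A⟦X⟧) = 0 := by simp [PowerSeries.coeff_one]
  have e1 := hs 0
  have e2 := hs 1
  have e3 := hs 2
  simp only [zero_add, Nat.reduceAdd, coeff_mul_zero, coeff_mul_one, coeff_mul_two, map_add, z0, c1, c2, c3,
    o0, o1, o2] at e1 e2 e3
  have z1 : PowerSeries.coeff 1 Z = 1 := by linear_combination e1
  rw [z1] at e2 e3
  have z2 : PowerSeries.coeff 2 Z = 4 := by linear_combination e2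
  rw [z2] at e3
  exact ⟨z0, z1, z2, by linear_combination e3⟩

/-- As `Z` has no constant term, the coefficient of `t^n` in `hν` involves the new unknown `coeff n
ν` only through `T (1 + ν)`, with coefficient `1`. The system is triangular. -/
theorem coeff_nu {Z ν : ℚ[X]⟦X⟧} (h0 : PowerSeries.X ∣ Z)
    (h : Z * (1 + Z ^ 2) = PowerSeries.X * (1 + Z) ^ 4)
    (hν : R 0 * ((1 + ν * Z) * (1 + ν * Z ^ 3)) = constU T * ((1 + ν) * (1 + ν * Z ^ 4))) :
    PowerSeries.coeff 0 ν = Polynomial.X - 1 ∧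
    PowerSeries.coeff 1 ν = (Polynomial.X - 1) * (2 * Polynomial.X) ∧
    PowerSeries.coeff 2 ν = (Polynomial.X - 1) * (7 * Polynomial.X + 6 * Polynomial.X ^ 2) ∧
    PowerSeries.coeff 3 ν = (Polynomial.X - 1) *
      (32 * Polynomial.X + 36 * Polynomial.X ^ 2 + 23 * Polynomial.X ^ 3) := by
  obtain ⟨z0, z1, z2, z3⟩ := coeff_Z h0 h
  obtain ⟨c0, c1, c2, c3⟩ := coeff_pow_three_of_X_dvd h0
  obtain ⟨t0, t1, t2, t3⟩ := coeff_T
  obtain ⟨r0, r1, r2, r3⟩ := coeff_R_zero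
  have o0 : PowerSeries.coeff 0 (1 : ℚ[X]⟦X⟧) = 1 := by simp
  have o1 : PowerSeries.coeff 1 (1 : ℚ[X]⟦X⟧) = 0 := by simp [PowerSeries.coeff_one]
  have o2 : PowerSeries.coeff 2 (1 : ℚ[X]⟦X⟧) = 0 := by simp [PowerSeries.coeff_one]
  have o3 : PowerSeries.coeff 3 (1 : ℚ[X]⟦X⟧) = 0 := by simp [PowerSeries.coeff_one]
  have e0 := congrArg (PowerSeries.coeff 0) hν
  have e1 := congrArg (PowerSeries.coeff 1) hν
  have e2 := congrArg (PowerSeries.coeff 2) hν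
  have e3 := congrArg (PowerSeries.coeff 3) hν
  simp only [pow_succ Z 3, coeff_mul_zero, coeff_mul_one, coeff_mul_two, coeff_mul_three, map_add,
    z0, z1, z2, z3, c0, c1, c2, c3, t0, t1, t2, t3, r0, r1, r2, r3, o0, o1, o2, o3] at e0 e1 e2 e3
  have n0 : PowerSeries.coeff 0 ν = Polynomial.X - 1 := by linear_combination -e0
  rw [n0] at e1 e2 e3
  have n1 : PowerSeries.coeff 1 ν = (Polynomial.X - 1) * (2 * Polynomial.X) := by
    linear_combination -e1
  rw [n1] at e2 e3
  have n2 : PowerSeries.coeff 2 ν =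
      (Polynomial.X - 1) * (7 * Polynomial.X + 6 * Polynomial.X ^ 2) := by
    linear_combination -e2
  rw [n2] at e3
  exact ⟨n0, n1, n2, by linear_combination -e3⟩

-- The series satisfy the algebraic system

theorem constantCoeff_constU (f : ℚ⟦X⟧) : PowerSeries.constantCoeff (constU f) =
    Polynomial.C (PowerSeries.constantCoeff f) := by
  rw [constU, ← PowerSeries.coeff_zero_eq_constantCoeff_apply, PowerSeries.coeff_map,
    PowerSeries.coeff_zero_eq_constantCoeff_apply]

theorem constantCoeff_constU_T : PowerSeries.constantCoeff (constU T) = 1 := by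
  rw [constantCoeff_constU, constantCoeff_T, map_one]

theorem constantCoeff_atTU_T : PowerSeries.constantCoeff (atTU T) = 1 := by
  rw [atTU_T_rec]; simp [t]

theorem map_eval_one_constU (f : ℚ⟦X⟧) :
    PowerSeries.map (Polynomial.evalRingHom (1 : ℚ)) (constU f) = f := by
  ext n
  simp [constU]

theorem exists_sqrt_disc : ∃ s : ℚ[X]⟦X⟧, PowerSeries.constantCoeff s = 2 ∧
    s ^ 2 = disc (constU T) (atTU T) := by
  -- This is `(disc - 4) / X`, computed from `T - 1 = 2XT^2` and `V - 1 = 2XuV^2`.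
  obtain ⟨s, h1, h2⟩ := exists_sq_eq_add_X_mul Polynomial.C
    (4 * (2 * constU T ^ 2 + 2 * u * atTU T ^ 2) +
      PowerSeries.X * (2 * constU T ^ 2 + 2 * u * atTU T ^ 2) ^ 2 -
      16 * PowerSeries.X * u * constU T ^ 3 * atTU T ^ 3)
  refine ⟨s, h1, ?_⟩
  rw [h2, disc]
  have hT : constU T - 1 = 2 * PowerSeries.X * constU T ^ 2 := by
    have := constU_T_rec
    rw [t] at this
    linear_combination this
  have hV : atTU T - 1 = 2 * PowerSeries.X * u * atTU T ^ 2 := by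
    have := atTU_T_rec
    rw [t] at this
    linear_combination this
  have hs : constU T + atTU T =
      2 + PowerSeries.X * (2 * constU T ^ 2 + 2 * u * atTU T ^ 2) := by
    linear_combination hT + hV
  rw [hT, hV, hs]
  ring

theorem rel_series {Z ν : ℚ[X]⟦X⟧} (hZX : PowerSeries.X ∣ Z)
    (hZ : Z * (1 + Z ^ 2) = PowerSeries.X * (1 + Z) ^ 4)
    (hT : constU T * (1 + Z ^ 2) = (1 + Z) ^ 2)
    (hν : R 0 * ((1 + ν * Z) * (1 + ν * Z ^ 3)) = constU T * ((1 + ν) * (1 + ν * Z ^ 4))) :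
    Rel (toK t) (toK u) (toK Z) (toK (constU T)) (toK (atTU T)) (toK (R 0)) (toK (R 1)) (toK ν) := by
  have cZ : PowerSeries.constantCoeff Z = 0 := PowerSeries.X_dvd_iff.1 hZX
  have cT := constantCoeff_constU_T
  have cV := constantCoeff_atTU_T
  have ct : PowerSeries.constantCoeff t = 0 := by simp [t]
  have cu : PowerSeries.constantCoeff u = Polynomial.X := by simp [u]
  have cν : PowerSeries.constantCoeff ν = Polynomial.X - 1 := by
    rw [← PowerSeries.coeff_zero_eq_constantCoeff_apply, (coeff_nu hZX hZ hν).1]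
  have hX1 : (Polynomial.X : ℚ[X]) - 1 ≠ 0 := Polynomial.X_sub_C_ne_zero 1
  -- All inequations of `Rel` except `t ≠ 0` follow from constant terms: `Z` and `t` have `0`, `T`
  -- and `V` have `1`, `u` and `ν` have `u` and `u - 1`.
  have hne : ∀ f : ℚ[X]⟦X⟧, PowerSeries.constantCoeff f ≠ 0 → toK f ≠ 0 :=
    fun _ => toK_ne_zero
  have hI := congrArg toK invariant_R_top
  have hJ := congrArg toK invariant_R_bot
  have hR1 := R_eq_product cZ hT hν 1
  rw [eq_div_iff (mul_ne_zero (hne _ (by simp [cZ])) (hne _ (by simp [cZ])))] at hR1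
  simp only [invariant, map_add, map_sub, map_mul, map_one] at hI hJ
  refine ⟨?_, ?_, ?_, ?_, ?_, ?_, ?_, ?_, ?_, ?_, ?_, ?_, ?_, ?_, ?_, ?_, ?_, ?_, ?_, ?_, ?_, ?_,
    ?_, ?_, ?_⟩
  · rw [t]
    simpa only [map_add, map_mul, map_one, map_pow] using congrArg toK hZ
  · simpa only [map_add, map_mul, map_one, map_pow] using congrArg toK hT
  · simpa only [map_add, map_mul, map_one, map_pow, map_ofNat] using congrArg toK constU_T_rec
  · simpa only [map_add, map_mul, map_one, map_pow, map_ofNat] using congrArg toK atTU_T_rec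
  · rw [t]; linear_combination hI
  · rw [t]; linear_combination hJ
  · simpa only [map_add, map_mul, map_one, map_pow] using congrArg toK hν
  · simpa only [map_add, map_mul, map_one, map_pow, Nat.reduceAdd, pow_one, Nat.cast_one] using hR1
  · rw [Ne, map_eq_zero_iff _ toK_injective]
    exact PowerSeries.X_ne_zero
  · exact hne _ (by rw [cu]; exact Polynomial.X_ne_zero)
  · rw [← sub_ne_zero, ← map_one toK, ← map_sub]
    exact hne _ (by rw [map_sub, cu, map_one]; exact hX1)
  · simpa only [map_sub, map_mul, map_one, map_ofNat] using hne (1 - 8 * t * u) (by simp [ct])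
  · rw [show 1 + toK Z ^ 2 = toK (1 + Z ^ 2) by simp only [map_add, map_one, map_pow]]
    exact hne _ (by simp [cZ])
  · simpa only [map_add, map_one] using hne (1 + Z) (by simp [cZ])
  · simpa only [map_sub, map_one] using hne (1 - Z) (by simp [cZ])
  · rw [show 1 - toK Z ^ 3 = toK (1 - Z ^ 3) by simp only [map_sub, map_one, map_pow]]
    exact hne _ (by simp [cZ])
  · exact hne _ (by rw [cν]; exact hX1)
  · simpa only [map_add, map_one, map_mul] using hne (1 + ν * Z) (by simp [cZ])
  · rw [show 1 + toK ν * toK Z ^ 2 = toK (1 + ν * Z ^ 2) by simp only [map_add, map_one, map_mul, map_pow]]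
    exact hne _ (by simp [cZ])
  · rw [show 1 + toK ν * toK Z ^ 3 = toK (1 + ν * Z ^ 3) by simp only [map_add, map_one, map_mul, map_pow]]
    exact hne _ (by simp [cZ])
  · rw [show 1 + toK ν * toK Z ^ 4 = toK (1 + ν * Z ^ 4) by simp only [map_add, map_one, map_mul, map_pow]]
    exact hne _ (by simp [cZ])
  · simpa only [map_sub, map_one, map_mul, map_ofNat] using
      hne (1 - 4 * constU T * (constU T - 1)) (by simp [cT])
  · simpa only [polyB, map_sub, map_mul] using
      hne (polyB (constU T) (atTU T)) (by simp [polyB, cT, cV])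
  · simpa only [polyD, map_sub, map_mul, map_add, map_pow, map_ofNat] using
      hne (polyD (constU T) (atTU T)) (by
        simp only [polyD, map_sub, map_mul, map_add, map_pow, map_ofNat, cT, cV]; norm_num)
  · simpa only [polyY, map_sub, map_mul, map_add, map_pow, map_ofNat] using
      hne (polyY (constU T) (atTU T)) (by
        simp only [polyY, map_sub, map_mul, map_add, map_pow, map_ofNat, cT, cV]; norm_num)

theorem toK_R_ne_zero (j : ℤ) : toK (R j) ≠ 0 := by
  apply toK_ne_zero
  rcases lt_or_ge 0 j with hj | hj
  · rw [constantCoeff_R_of_pos hj]; exact one_ne_zero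
  · rw [constantCoeff_R_of_nonpos hj]; exact Polynomial.X_ne_zero

theorem toK_t_ne_zero : toK t ≠ 0 := by
  rw [Ne, map_eq_zero_iff _ toK_injective]
  exact PowerSeries.X_ne_zero

theorem toK_R_neighbours_mem {E : Subfield K} (ht : toK t ∈ E) (hu : toK u ∈ E) {j : ℤ}
    (h : toK (R j) ∈ E) : toK (R (j - 1)) + toK (R (j + 1)) ∈ E := by
  obtain ⟨w, hw, e⟩ : ∃ w ∈ E, toK (R j) = w + toK t * toK (R j) *
      (toK (R (j - 1)) + toK (R (j + 1))) := by
    rcases lt_or_ge 0 j with hj | hj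
    · refine ⟨1, one_mem _, ?_⟩
      have := congrArg toK (R_rec_of_pos hj)
      rwa [map_add, map_mul, map_mul, map_add, map_one] at this
    · refine ⟨toK u, hu, ?_⟩
      have := congrArg toK (R_rec_of_nonpos hj)
      rwa [map_add, map_mul, map_mul, map_add] at this
  have e' : toK (R (j - 1)) + toK (R (j + 1)) = (toK (R j) - w) / (toK t * toK (R j)) := by
    rw [eq_div_iff (mul_ne_zero toK_t_ne_zero (toK_R_ne_zero j))]
    linear_combination -e
  rw [e']
  exact div_mem (sub_mem h hw) (mul_mem ht h)

/-- Solved for `R_{j-1} + R_{j+1}`, the recursion propagates membership from the pair `R_0`, `R_1`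
in both directions. -/
theorem toK_R_mem {E : Subfield K} (ht : toK t ∈ E) (hu : toK u ∈ E) (h0 : toK (R 0) ∈ E)
    (h1 : toK (R 1) ∈ E) (j : ℤ) : toK (R j) ∈ E := by
  have hpos : ∀ n : ℕ, toK (R n) ∈ E ∧ toK (R (n + 1)) ∈ E := by
    intro n
    induction n with
    | zero => simpa using ⟨h0, h1⟩
    | succ n ih =>
      have := sub_mem (toK_R_neighbours_mem ht hu ih.2) ih.1
      rw [add_sub_cancel_right (n : ℤ) 1, add_sub_cancel_left] at this
      push_cast
      exact ⟨ih.2, this⟩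
  have hneg : ∀ n : ℕ, toK (R (-n)) ∈ E ∧ toK (R (-n + 1)) ∈ E := by
    intro n
    induction n with
    | zero => simpa using ⟨h0, h1⟩
    | succ n ih =>
      have := sub_mem (toK_R_neighbours_mem ht hu ih.1) ih.2
      rw [add_sub_cancel_right] at this
      push_cast
      rw [show -((n : ℤ) + 1) = -n - 1 by ring, sub_add_cancel]
      exact ⟨this, ih.1⟩
  obtain ⟨n, rfl | rfl⟩ := j.eq_nat_or_neg
  · exact (hpos n).1
  · exact (hneg n).1

end LTree

end

-- Assembly

open LTree IntermediateField in
theorem proposition7 :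
    -- algebraicity of `R_j` for all integers `j`
    (∀ j : ℤ,
      LTree.DegreeLE (LTree.fieldGen (LTree.constU LTree.T) (LTree.atTU LTree.T)) (LTree.R j) 2 ∧
      LTree.DegreeLE (LTree.fieldGen LTree.t LTree.u) (LTree.R j) 8) ∧
    -- the square root generating the extension that contains all the `R_j`
    (∃ s : ℚ[X]⟦X⟧,
      PowerSeries.constantCoeff s = 2 ∧
      s ^ 2 = (LTree.constU LTree.T + LTree.atTU LTree.T) ^ 2
        - 4 * LTree.constU LTree.T * LTree.atTU LTree.T
          * (LTree.constU LTree.T - 1) * (LTree.atTU LTree.T - 1) ∧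
      ∀ j : ℤ, LTree.toK (LTree.R j) ∈
        IntermediateField.adjoin
          (LTree.fieldGen (LTree.constU LTree.T) (LTree.atTU LTree.T)) {LTree.toK s}) ∧
    -- the product form
    (∃ Z : ℚ⟦X⟧, LTree.IsZ Z ∧ (∀ Z' : ℚ⟦X⟧, LTree.IsZ Z' → Z' = Z) ∧
      ∃ ν : ℚ[X]⟦X⟧,
        (∀ j : ℕ,
          LTree.toK (LTree.R j) =
            LTree.toK (LTree.constU LTree.T) *
              (LTree.toK (1 + ν * LTree.constU Z ^ j)
                * LTree.toK (1 + ν * LTree.constU Z ^ (j + 4))) /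
              (LTree.toK (1 + ν * LTree.constU Z ^ (j + 1))
                * LTree.toK (1 + ν * LTree.constU Z ^ (j + 3)))) ∧
        LTree.DegreeEq (LTree.fieldGen LTree.u (LTree.constU Z)) ν 4 ∧
        LTree.DegreeEq (LTree.fieldGen LTree.t LTree.u) ν 16 ∧
        PowerSeries.map (Polynomial.evalRingHom (1 : ℚ)) ν = 0 ∧
        PowerSeries.coeff 0 ν = Polynomial.X - 1 ∧
        PowerSeries.coeff 1 ν = (Polynomial.X - 1) * (2 * Polynomial.X) ∧
        PowerSeries.coeff 2 ν =
          (Polynomial.X - 1) * (7 * Polynomial.X + 6 * Polynomial.X ^ 2) ∧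
        PowerSeries.coeff 3 ν =
          (Polynomial.X - 1) *
            (32 * Polynomial.X + 36 * Polynomial.X ^ 2 + 23 * Polynomial.X ^ 3)) := by
  obtain ⟨Z, hZX, hZ⟩ := exists_isZ
  have hZX' : PowerSeries.X ∣ constU Z := by
    obtain ⟨Y, rfl⟩ := hZX
    exact ⟨constU Y, by rw [constU, constU, map_mul, PowerSeries.map_X]⟩
  have hZ' : constU Z * (1 + constU Z ^ 2) = PowerSeries.X * (1 + constU Z) ^ 4 := by
    have := congrArg (PowerSeries.map Polynomial.C) hZ
    rw [constU]
    simpa only [map_mul, map_add, map_one, map_pow, PowerSeries.map_X] using this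
  have hT' : constU T * (1 + constU Z ^ 2) = (1 + constU Z) ^ 2 := by
    have := congrArg (PowerSeries.map Polynomial.C) (T_mul_one_add_sq hZX hZ)
    rw [constU, constU]
    simpa only [map_mul, map_add, map_one, map_pow] using this
  obtain ⟨ν, hfix⟩ := exists_fixed_of_contraction
    (nuMap_contraction (T := constU T) (a := R 0) hZX')
  have hTrec := constU_T_rec
  rw [LTree.t] at hTrec
  have hν := nuMap_fixed hTrec hfix
  have h := rel_series hZX' hZ' hT' hν
  have hind := algebraicIndependent_t_u
  obtain ⟨hu, ht⟩ := Rel.transcendental_of_algebraicIndependent hind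
  obtain ⟨s, hs0, hs⟩ := exists_sqrt_disc
  have hsK : toK s ^ 2 = disc (toK (constU T)) (toK (atTU T)) := by
    rw [← map_pow, hs]
    simp only [disc, map_sub, map_add, map_mul, map_pow, map_one, map_ofNat]
  have hmem : ∀ E : Subfield K, toK (constU T) ∈ E → toK (atTU T) ∈ E → toK s ∈ E →
      ∀ j, toK (R j) ∈ E := by
    intro E h1 h2 h3
    obtain ⟨hx, hy⟩ := h.mem_of_sq_eq_disc h1 h2 h3 hsK
    exact toK_R_mem (h.t_mem h1) (h.u_mem h1 h2) hx hy
  let F : IntermediateField ℚ K := fieldGen (constU T) (atTU T)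
  let G : IntermediateField ℚ K := F ⊔ adjoin ℚ {toK s}
  have hTF : toK (constU T) ∈ F := Rel.left_mem _ _
  have hVF : toK (atTU T) ∈ F := Rel.right_mem _ _
  have hsG : toK s ∈ G := le_sup_right (a := F) (mem_adjoin_simple_self ℚ (toK s))
  have hRG : ∀ j, toK (R j) ∈ G := hmem G.toSubfield (le_sup_left (a := F) hTF)
    (le_sup_left (a := F) hVF) hsG
  have hdisc : disc (toK (constU T)) (toK (atTU T)) ∈ F :=
    sub_mem (pow_mem (add_mem hTF hVF) 2) (mul_mem (mul_mem (mul_mem (mul_mem (ofNat_mem _ 4) hTF)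
      hVF) (sub_mem hTF (one_mem _))) (sub_mem hVF (one_mem _)))
  have hFG := relfinrank_quadratic_le (le_sup_left : F ≤ G) hsG le_rfl (zero_mem F) hdisc
    (by rw [hsK, zero_mul, zero_add])
  have hTu : adjoin ℚ {toK (constU T), toK LTree.u} ≤ F :=
    adjoin_le_iff.2 (Rel.pair_subset hTF (h.u_mem (E := F.toSubfield) hTF hVF))
  have hTt := h.relfinrank_t_T ht
  have hTuF : 0 < relfinrank (adjoin ℚ {toK (constU T), toK LTree.u}) F ∧
      relfinrank (adjoin ℚ {toK (constU T), toK LTree.u}) F ≤ 2 := by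
    have hm : 1 / (2 * toK LTree.t * toK LTree.u) ∈
        adjoin ℚ {toK (constU T), toK LTree.u} :=
      div_mem (one_mem _) (mul_mem (mul_mem (ofNat_mem _ 2) (h.t_mem
        (E := (adjoin ℚ {toK (constU T), toK LTree.u}).toSubfield) (Rel.left_mem _ _)))
        (Rel.right_mem _ _))
    refine relfinrank_quadratic_le hTu hVF ?_ hm (neg_mem hm) h.V_quadratic
    exact adjoin_le_iff.2 (Rel.pair_subset
      (le_sup_left (b := adjoin ℚ {toK (atTU T)}) (Rel.left_mem _ _))
      (le_sup_right (a := adjoin ℚ {toK (constU T), toK LTree.u})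
        (mem_adjoin_simple_self ℚ (toK (atTU T)))))
  have h8 : 0 < relfinrank (fieldGen LTree.t LTree.u) G ∧
      relfinrank (fieldGen LTree.t LTree.u) G ≤ 8 := by
    have e1 := relfinrank_mul_relfinrank h.adjoin_t_T_le.1 (hTu.trans (le_sup_left : F ≤ G))
    have e2 := relfinrank_mul_relfinrank hTu (le_sup_left : F ≤ G)
    rw [hTt, ← e2] at e1
    rw [fieldGen, ← e1]
    exact ⟨Nat.mul_pos two_pos (Nat.mul_pos hTuF.1 hFG.1),
      Nat.mul_le_mul_left 2 (Nat.mul_le_mul hTuF.2 hFG.2)⟩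
  have htG : fieldGen LTree.t LTree.u ≤ G :=
    h.adjoin_t_T_le.1.trans (hTu.trans le_sup_left)
  have hνm : toK ν ∈ adjoin ℚ {toK (constU Z), toK (atTU T)} ⊔ adjoin ℚ {toK ν} :=
    le_sup_right (a := adjoin ℚ {toK (constU Z), toK (atTU T)})
      (mem_adjoin_simple_self ℚ (toK ν))
  have hIsZ := isZ_iff.2 ⟨hZX, hZ⟩
  refine ⟨fun j => ⟨degreeLE_of_relfinrank le_sup_left hFG.1 hFG.2 (hRG j),
    degreeLE_of_relfinrank htG h8.1 h8.2 (hRG j)⟩, ⟨s, hs0, hs, ?_⟩,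
    Z, hIsZ, fun Z' hZ' => isZ_unique hIsZ hZ', ν,
    R_eq_product (PowerSeries.X_dvd_iff.1 hZX') hT' hν,
    degreeEq_of_relfinrank (h.Z_le_V.trans le_sup_left) (by norm_num) (h.relfinrank_Z_ν hu) hνm
      h.adjoin_le_Z_sup_ν,
    degreeEq_of_relfinrank (h.adjoin_t_T_le.1.trans (h.T_le_Z.trans
      (h.Z_le_V.trans le_sup_left))) (by norm_num) (h.relfinrank_t_ν hu ht) hνm
      (h.adjoin_le_t_sup_ν hind), ?_, coeff_nu hZX' hZ' hν⟩
  · exact hmem (adjoin F {toK s}).toSubfield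
      (IntermediateField.algebraMap_mem (adjoin F {toK s}) (⟨_, hTF⟩ : F))
      (IntermediateField.algebraMap_mem (adjoin F {toK s}) (⟨_, hVF⟩ : F))
      (mem_adjoin_simple_self F (toK s))
  -- At `u = 1` the series `R_0` becomes `T`, and then `0` is also a fixed point of `nuMap`.
  · refine eq_of_fixed_of_contraction (nuMap_contraction (T := T) (a := T) hZX) ?_ ?_
    · have := congrArg (PowerSeries.map (Polynomial.evalRingHom (1 : ℚ))) hfix
      simpa only [nuMap, map_sub, map_mul, map_add, map_one, map_pow, map_ofNat,
        PowerSeries.map_X, map_eval_one_R, map_eval_one_constU] using this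
    · rw [nuMap]
      linear_combination T_rec
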